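/- All graphs are finite and simple; $N_G(v)$ and $d_G(v)$ denote the neighbourhood and the degree of $v$ in $G$, and $n=|V(G)|$. A graph is 2-connected if it has at least three vertices, is connected and has no cut vertex. **Small graphs.** $K_{1,3}$ is the claw, $P_k$ the path on $k$ vertices, $C_3$ the triangle, and $Z_k$ the graph obtained by identifying a vertex of a triangle with an end vertex of a $P_{k+1}$. The bull $B$ is a triangle with one pendant edge at each of two of its vertices; the net $N$ is a triangle $a_1a_2a_3$ with one pendant edge $a_ib_i$ at each $a_i$; the wounded $W$ is a triangle with a pendant edge at one vertex and a pendant path with two edges at another vertex. **Heaviness.** A vertex $v$ is heavy in $G$ if $d_G(v)\ge n/2$. A pair of distinct vertices $u,v$ with $d_G(u)+d_G(v)\ge n$ is an $o$-heavy pair if $uv\notin E(G)$ and an $a$-heavy pair if $uv\in E(G)$. $G$ is $\{K_{1,3},S\}$-$o$-heavy if every induced subgraph of $G$ isomorphic to $K_{1,3}$ or to $S$ contains an $o$-heavy pair of $G$. An induced net of $G$, with vertices labelled $a_i,b_i$ as above, is $p$-heavy if $\{a_1,a_2,a_3\}$ contains an $a$-heavy pair of $G$; it is $q$-heavy if for some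 $i\in\{1,2,3\}$ the vertices $a_i,b_i$ are heavy in $G$ and, for each $j\ne i$, $d_G(a_j)=3$, $d_G(b_j)=2$ and the neighbour of $b_j$ other than $a_j$ is heavy in $G$. $G$ is $N$-$pq$-heavy if every induced net of $G$ is $p$-heavy or $q$-heavy. **The $c$-closure.** For a vertex $x$ let $G^{BC}_x$ be obtained from $G$ by adding an edge between every $o$-heavy pair of $G$ contained in $N_G(x)$. The vertex $x$ is $c$-eligible in $G$ if $N_G(x)$ is not a clique of $G$ and either (i) $G^{BC}_x[N_G(x)]$ is connected, or (ii) $G^{BC}_x[N_G(x)]$ is the disjoint union of two cliques $C_1$ and $C_2$, and there is an $o$-heavy pair $\{x,z\}$ of $G$ such that $zy_1,zy_2\in E(G)$ for some $y_1\in C_1$, $y_2\in C_2$. The local $c$-completion of $G$ at $x$ is obtained by adding all missing edges between vertices of $N_G(x)$. A $c$-closure $\mathrm{cl}_c(G)$ of $G$ is a graph without $c$-eligible vertices obtained from $G$ by successively performing local $c$-completions at vertices that are $c$-eligible in the current graph. **Theorem.** Let $G$ be a 2-connected $\{K_{1,3},S\}$-$o$-heavy graph, where $S\in\{P_4,P_5,C_3,Z_1,Z_2,B,N,W\}$.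 Then $\mathrm{cl}_c(G)$ (whatever order of completions is used) is claw-free and $N$-$pq$-heavy. -/

import Mathlib

namespace HeavyPairs

universe u v

/-! ### The small graphs -/

/-- The claw `K_{1,3}`. -/
def claw : SimpleGraph (Fin 1 ⊕ Fin 3) :=
  completeBipartiteGraph (Fin 1) (Fin 3)

/-- The path `P_k` on `k` vertices. -/
def P (k : ℕ) : SimpleGraph (Fin k) :=
  SimpleGraph.pathGraph k

/-- The triangle `C_3`. -/
def C₃ : SimpleGraph (Fin 3) :=
  SimpleGraph.cycleGraph 3

/-- `Z_k`: the triangle `0, 1, 2` whose vertex `2` is identified with an end vertex of the path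
`2, 3, …, k + 2` on `k + 1` vertices. -/
def Z (k : ℕ) : SimpleGraph (Fin (k + 3)) :=
  SimpleGraph.pathGraph (k + 3) ⊔ SimpleGraph.edge ⟨0, by omega⟩ ⟨2, by omega⟩

/-- The bull: the triangle `0, 1, 2` with pendant edges `0 3` and `1 4`. -/
def bull : SimpleGraph (Fin 5) :=
  SimpleGraph.fromEdgeSet {s(0, 1), s(1, 2), s(0, 2), s(0, 3), s(1, 4)}

/-- The wounded: the triangle `0, 1, 2` with a pendant edge `0 3` and a pendant path `1 4 5`. -/
def wounded : SimpleGraph (Fin 6) :=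
  SimpleGraph.fromEdgeSet {s(0, 1), s(1, 2), s(0, 2), s(0, 3), s(1, 4), s(4, 5)}

/-- The net: the vertices `a i = Sum.inl i` form a triangle, and `b i = Sum.inr i` is a pendant
vertex attached to `a i`. -/
def net : SimpleGraph (Fin 3 ⊕ Fin 3) where
  Adj
    | Sum.inl i, Sum.inl j => i ≠ j
    | Sum.inl i, Sum.inr j => i = j
    | Sum.inr i, Sum.inl j => i = j
    | Sum.inr _, Sum.inr _ => False
  symm := ⟨by
    rintro (i | i) (j | j) h
    · exact Ne.symm h
    · exact Eq.symm h
    · exact Eq.symm h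
    · exact h⟩
  loopless := ⟨by
    rintro (i | i) h
    · exact h rfl
    · exact h⟩

/-! ### Connectivity, degrees, heavy vertices and heavy pairs -/

section Graphs

variable {V : Type u}

/-- `G` is 2-connected: it has at least three vertices, is connected, and has no cut vertex. -/
def TwoConnected [Fintype V] (G : SimpleGraph V) : Prop :=
  3 ≤ Fintype.card V ∧ G.Connected ∧ ∀ v : V, (G.induce {w | w ≠ v}).Connected

/-- `G` is claw-free: no induced subgraph of `G` is isomorphic to the claw. -/
def ClawFree (G : SimpleGraph V) : Prop :=
  ¬ claw.IsIndContained G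

open scoped Classical in
/-- The degree of `v` in `G`. -/
noncomputable def deg [Fintype V] (G : SimpleGraph V) (v : V) : ℕ :=
  G.degree v

/-- `v` is heavy in `G`: `d(v) ≥ |V(G)| / 2`. -/
def Heavy [Fintype V] (G : SimpleGraph V) (v : V) : Prop :=
  Fintype.card V ≤ 2 * deg G v

/-- `{u, v}` is an `o`-heavy pair of `G`: nonadjacent with degree sum at least `|V(G)|`. -/
def OHeavyPair [Fintype V] (G : SimpleGraph V) (u v : V) : Prop :=
  u ≠ v ∧ ¬ G.Adj u v ∧ Fintype.card V ≤ deg G u + deg G v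

/-- `{u, v}` is an `a`-heavy pair of `G`: adjacent with degree sum at least `|V(G)|`. -/
def AHeavyPair [Fintype V] (G : SimpleGraph V) (u v : V) : Prop :=
  G.Adj u v ∧ Fintype.card V ≤ deg G u + deg G v

/-- `G` is `H`-`o`-heavy: every induced subgraph of `G` isomorphic to `H` contains an `o`-heavy
pair of `G`. -/
def OHeavyFor [Fintype V] {W : Type v} (H : SimpleGraph W) (G : SimpleGraph V) : Prop :=
  ∀ φ : H ↪g G, ∃ i j : W, OHeavyPair G (φ i) (φ j)

/-- An induced net of `G` is `p`-heavy if its triangle contains an `a`-heavy pair of `G`. -/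
def PHeavyNet [Fintype V] (G : SimpleGraph V) (φ : net ↪g G) : Prop :=
  ∃ i j : Fin 3, AHeavyPair G (φ (Sum.inl i)) (φ (Sum.inl j))

/-- An induced net of `G` is `q`-heavy if, for some `i`, both `a i` and `b i` are heavy, and for
each `j ≠ i`, `d(a j) = 3`, `d(b j) = 2` and the neighbour of `b j` other than `a j` is heavy. -/
def QHeavyNet [Fintype V] (G : SimpleGraph V) (φ : net ↪g G) : Prop :=
  ∃ i : Fin 3,
    (Heavy G (φ (Sum.inl i)) ∧ Heavy G (φ (Sum.inr i))) ∧
    ∀ j : Fin 3, j ≠ i →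
      deg G (φ (Sum.inl j)) = 3 ∧ deg G (φ (Sum.inr j)) = 2 ∧
      ∀ c : V, G.Adj (φ (Sum.inr j)) c → c ≠ φ (Sum.inl j) → Heavy G c

/-- `G` is `N`-`pq`-heavy: every induced net of `G` is `p`-heavy or `q`-heavy. -/
def NPQHeavy [Fintype V] (G : SimpleGraph V) : Prop :=
  ∀ φ : net ↪g G, PHeavyNet G φ ∨ QHeavyNet G φ

/-! ### The `c`-closure -/

/-- The graph `G^{BC}_x`: the `o`-heavy pairs of `G` inside `N(x)` are added as edges. -/
def bcGraph [Fintype V] (G : SimpleGraph V) (x : V) : SimpleGraph V where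
  Adj u v := G.Adj u v ∨ (G.Adj x u ∧ G.Adj x v ∧ OHeavyPair G u v)
  symm := ⟨by
    rintro u v (h | ⟨hu, hv, hne, hadj, hd⟩)
    · exact Or.inl h.symm
    · exact Or.inr ⟨hv, hu, hne.symm, fun h => hadj h.symm, by rwa [add_comm]⟩⟩
  loopless := ⟨by
    rintro u (h | ⟨_, _, hne, _⟩)
    · exact G.loopless.irrefl u h
    · exact hne rfl⟩

/-- `x` is `c`-eligible in `G`: `N(x)` is not a clique of `G`, and either `G^{BC}_x[N(x)]` is
connected, or it is the disjoint union of two cliques `C₁`, `C₂` and there is an `o`-heavy pair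
`{x, z}` of `G` such that `z` has a neighbour in `G` in each of `C₁` and `C₂`. -/
def CEligible [Fintype V] (G : SimpleGraph V) (x : V) : Prop :=
  ¬ G.IsClique (G.neighborSet x) ∧
  (((bcGraph G x).induce (G.neighborSet x)).Connected ∨
    ∃ C₁ C₂ : Set V,
      (C₁ ∪ C₂ = G.neighborSet x ∧ Disjoint C₁ C₂ ∧
        (bcGraph G x).IsClique C₁ ∧ (bcGraph G x).IsClique C₂ ∧
        ∀ u ∈ C₁, ∀ v ∈ C₂, ¬ (bcGraph G x).Adj u v) ∧
      ∃ z : V, OHeavyPair G x z ∧ (∃ y₁ ∈ C₁, G.Adj z y₁) ∧ (∃ y₂ ∈ C₂, G.Adj z y₂))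

/-- The local `c`-completion of `G` at `x`: all missing edges inside `N(x)` are added. -/
def localCompletion (G : SimpleGraph V) (x : V) : SimpleGraph V where
  Adj u v := G.Adj u v ∨ (u ≠ v ∧ G.Adj x u ∧ G.Adj x v)
  symm := ⟨by
    rintro u v (h | ⟨hne, hu, hv⟩)
    · exact Or.inl h.symm
    · exact Or.inr ⟨hne.symm, hv, hu⟩⟩
  loopless := ⟨by
    rintro u (h | ⟨hne, _⟩)
    · exact G.loopless.irrefl u h
    · exact hne rfl⟩

/-- One step of the closure: local `c`-completion at a `c`-eligible vertex. -/
def CStep [Fintype V] (G G' : SimpleGraph V) : Prop :=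
  ∃ x : V, CEligible G x ∧ G' = localCompletion G x

/-- `H` is the `c`-closure of `G`: it is obtained from `G` by successive local `c`-completions at
`c`-eligible vertices (of the current graph), and has no `c`-eligible vertex. -/
def IsCClosure [Fintype V] (G H : SimpleGraph V) : Prop :=
  Relation.ReflTransGen CStep G H ∧ ∀ x : V, ¬ CEligible H x

theorem CStep.lt [Fintype V] {G G' : SimpleGraph V} (h : CStep G G') : G < G' := by
  obtain ⟨x, ⟨hx, -⟩, rfl⟩ := h
  refine lt_of_le_not_ge (fun u v huv => Or.inl huv) fun hle => hx ?_
  intro u hu v hv hne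
  exact hle (Or.inr ⟨hne, hu, hv⟩)

/-- Every finite graph has a `c`-closure, as each step adds an edge. -/
theorem exists_isCClosure [Fintype V] (G : SimpleGraph V) : ∃ H, IsCClosure G H := by
  induction G using (wellFounded_gt (α := SimpleGraph V)).induction with
  | _ G ih =>
    by_cases h : ∃ x, CEligible G x
    · obtain ⟨x, hx⟩ := h
      have hs : CStep G (localCompletion G x) := ⟨x, hx, rfl⟩
      obtain ⟨H, hH, hH'⟩ := ih _ hs.lt
      exact ⟨H, Relation.ReflTransGen.head hs hH, hH'⟩
    · exact ⟨G, Relation.ReflTransGen.refl, fun x hx => h ⟨x, hx⟩⟩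

end Graphs

end HeavyPairs

/-! Induced subgraphs of a completion need not be induced in `G`, so the argument follows weighted
patterns that can be pulled back through a completion at any vertex `x`, eligible or not. Degrees
only grow, so a `Far` pair of the completion is `Far` in `G`. A `Light` edge that is new has gained
a neighbour at each end, hence was a `Far` pair. A neighbour of `x` ends with degree at least that
of `x`, so `x` may replace it. With these rules `PatternQ`, `PatternF`, `PatternY` and `PatternZ`
each pull back to the same pattern or to `PatternQ`, and `PatternNet` pulls back to itself. The
first four contain both a `P 5` and a `wounded` without `o`-heavy pairs. Since `P 4` embeds in `P
5`, and `C₃`, `Z 1`, `Z 2`, `bull` embed in `wounded`, they are absent from `G` and from its closure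
unless `S` is the net, where `PatternNet` is excluded instead.

Stability of `NoClaw` and the absence of eligible vertices leave no `o`-heavy pair in the closure
`H` (`NoClaw.not_oHeavyPair`), so each neighbourhood is a clique or two cliques with no edge between
them (`IsClosed`); claw-freeness follows. If `S` is the net, every net of `H` is then `p`-heavy.

Otherwise take a net that is not `p`-heavy. By 2-connectedness the clique of branches at a triangle
vertex has an edge leaving it that avoids that vertex. Without `PatternQ` and `PatternF`, this
forces a heavy branch at some triangle vertex, say `a₁`. The same patterns then make `b₂` and `b₃`
of degree two with second neighbours among the branches at `a₁`. Excluding `PatternY` gives `a₂` and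
`a₃` degree three, and excluding `PatternZ` makes the clique of `a₁` and its branches so large that
all its vertices are heavy: the net is `q`-heavy. -/

namespace HeavyPairs

/-! ### Degree bounds and their transfer through one completion -/

section Basic

variable {V : Type*} [Fintype V]

/-- `u` and `w` are distinct and nonadjacent, and do not form an `o`-heavy pair. -/
def Far (G : SimpleGraph V) (u w : V) : Prop :=
  u ≠ w ∧ ¬ G.Adj u w ∧ deg G u + deg G w < Fintype.card V

/-- `u` and `w` are adjacent with degree sum at most `|V(G)| + 1`. -/
def Light (G : SimpleGraph V) (u w : V) : Prop :=
  G.Adj u w ∧ deg G u + deg G w < Fintype.card V + 2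

/-- Adjacent with degree sum at most `|V(G)| + 2`, or nonadjacent with degree sum at most
`|V(G)|`. -/
def Moderate (G : SimpleGraph V) (u w : V) : Prop :=
  (G.Adj u w → deg G u + deg G w < Fintype.card V + 3) ∧
    (¬ G.Adj u w → deg G u + deg G w < Fintype.card V + 1)

variable {G : SimpleGraph V} {u v w x y z p q r s : V}

theorem Far.symm (h : Far G u w) : Far G w u :=
  ⟨h.1.symm, fun h' => h.2.1 h'.symm, by rw [add_comm]; exact h.2.2⟩

theorem Light.symm (h : Light G u w) : Light G w u :=
  ⟨h.1.symm, by rw [add_comm]; exact h.2⟩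

theorem deg_eq_card (G : SimpleGraph V) (v : V) (s : Finset V)
    (hs : ∀ w, w ∈ s ↔ G.Adj v w) : deg G v = s.card := by
  classical
  unfold deg
  rw [← SimpleGraph.card_neighborFinset_eq_degree]
  congr 1
  ext w
  simp [hs]

theorem deg_le_card (G : SimpleGraph V) (v : V) (s : Finset V)
    (hs : ∀ w, G.Adj v w → w ∈ s) : deg G v ≤ s.card := by
  classical
  rw [deg_eq_card G v (Finset.univ.filter fun w => G.Adj v w) (by simp)]
  exact Finset.card_le_card fun w => by simpa using hs w

theorem card_le_deg (G : SimpleGraph V) (v : V) (s : Finset V)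
    (hs : ∀ w ∈ s, G.Adj v w) : s.card ≤ deg G v := by
  classical
  rw [deg_eq_card G v (Finset.univ.filter fun w => G.Adj v w) (by simp)]
  exact Finset.card_le_card fun w => by simpa using hs w

theorem deg_mono {G' : SimpleGraph V} (h : G ≤ G') (v : V) : deg G v ≤ deg G' v := by
  classical
  rw [deg_eq_card G v (Finset.univ.filter fun w => G.Adj v w) (by simp)]
  exact card_le_deg _ _ _ fun w hw => h (by simpa using hw)

theorem le_localCompletion {V : Type*} (G : SimpleGraph V) (x : V) : G ≤ localCompletion G x :=
  fun _ _ h => Or.inl h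

theorem localCompletion_adj {V : Type*} {G : SimpleGraph V} {x u v : V} :
    (localCompletion G x).Adj u v ↔ G.Adj u v ∨ (u ≠ v ∧ G.Adj x u ∧ G.Adj x v) := Iff.rfl

/-- A vertex gains at least as many neighbours as there are new edges at it. -/
theorem deg_add_card_le (s : Finset V) (hu : G.Adj x u)
    (hs : ∀ w ∈ s, w ≠ u ∧ G.Adj x w ∧ ¬ G.Adj u w) :
    deg G u + s.card ≤ deg (localCompletion G x) u := by
  classical
  rw [deg_eq_card G u (Finset.univ.filter fun w => G.Adj u w) (by simp),
    ← Finset.card_union_of_disjoint]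
  · refine card_le_deg _ _ _ fun w hw => ?_
    rcases Finset.mem_union.1 hw with h | h
    · exact Or.inl (by simpa using h)
    · exact Or.inr ⟨(hs w h).1.symm, hu, (hs w h).2.1⟩
  · rw [Finset.disjoint_left]
    intro w hw hw'
    exact (hs w hw').2.2 (by simpa using hw)

/-- After the completion at `x`, a neighbour `p` of `x` dominates `x`. -/
theorem deg_center_add_card_le (s : Finset V) (hp : G.Adj x p)
    (hs : ∀ w ∈ s, G.Adj p w ∧ w ≠ x ∧ ¬ G.Adj x w) :
    deg G x + s.card ≤ deg (localCompletion G x) p := by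
  classical
  have h1 : deg G x = ((insert x (Finset.univ.filter fun w => G.Adj x w)).erase p).card := by
    rw [Finset.card_erase_of_mem (by simp [hp]), Finset.card_insert_of_notMem (by simp)]
    rw [deg_eq_card G x (Finset.univ.filter fun w => G.Adj x w) (by simp)]
    simp
  rw [h1, ← Finset.card_union_of_disjoint]
  · refine card_le_deg _ _ _ fun w hw => ?_
    rcases Finset.mem_union.1 hw with h | h
    · simp only [Finset.mem_erase, Finset.mem_insert, Finset.mem_filter, Finset.mem_univ,
        true_and] at h
      rcases h.2 with rfl | h'
      · exact Or.inl hp.symm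
      · exact Or.inr ⟨h.1.symm, hp, h'⟩
    · exact Or.inl (hs w h).1
  · rw [Finset.disjoint_left]
    intro w hw hw'
    simp only [Finset.mem_erase, Finset.mem_insert, Finset.mem_filter, Finset.mem_univ,
        true_and] at hw
    rcases hw.2 with h | h
    · exact (hs w hw').2.1 h
    · exact (hs w hw').2.2 h

theorem deg_center_le (hp : G.Adj x p) : deg G x ≤ deg (localCompletion G x) p := by
  simpa using deg_center_add_card_le (G := G) (x := x) (p := p) ∅ hp (by simp)

/-! ### Transfer from the completion back to the graph -/

theorem Far.of_completion (h : Far (localCompletion G x) u w) : Far G u w := by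
  refine ⟨h.1, fun h' => h.2.1 (Or.inl h'), ?_⟩
  have := deg_mono (le_localCompletion G x) u
  have := deg_mono (le_localCompletion G x) w
  have := h.2.2
  omega

theorem Light.of_completion (h : Light (localCompletion G x) u w) (huw : G.Adj u w) :
    Light G u w := by
  refine ⟨huw, ?_⟩
  have := deg_mono (le_localCompletion G x) u
  have := deg_mono (le_localCompletion G x) w
  have := h.2
  omega

theorem Light.mem (h : Light (localCompletion G x) u w) (huw : ¬ G.Adj u w) :
    G.Adj x u ∧ G.Adj x w :=
  (h.1.resolve_left huw).2

/-- Each end gains the other as a neighbour, so the degree sum drops by two on going back. This is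
why the threshold of `Light` is `n + 2`. -/
theorem Light.far (h : Light (localCompletion G x) u w) (huw : ¬ G.Adj u w) : Far G u w := by
  obtain ⟨hne, hu, hw⟩ := h.1.resolve_left huw
  have h1 := deg_add_card_le (G := G) {w} hu (by simpa using ⟨hne.symm, hw, huw⟩)
  have h2 := deg_add_card_le (G := G) {u} hw
    (by simpa using ⟨hne, hu, fun h => huw h.symm⟩)
  have := h.2
  simp only [Finset.card_singleton] at h1 h2
  exact ⟨hne, huw, by omega⟩

/-- After the completion `p` has degree at least that of `x`, so `x` inherits every far relation of
`p` and can stand in for it. -/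
theorem Far.center (h : Far (localCompletion G x) p y) (hp : G.Adj x p) : Far G x y := by
  refine ⟨?_, fun h' => h.2.1 (Or.inr ⟨h.1, hp, h'⟩), ?_⟩
  · rintro rfl
    exact h.2.1 (Or.inl hp.symm)
  · have := deg_mono (le_localCompletion G x) y
    have := deg_center_le hp
    have := h.2.2
    omega

theorem Light.center (h : Light (localCompletion G x) p y) (hp : G.Adj x p) (hy : G.Adj x y) :
    Light G x y := by
  refine ⟨hy, ?_⟩
  have := deg_mono (le_localCompletion G x) y
  have := deg_center_le hp
  have := h.2
  omega

/-- In the completion `p` sees the rest of the closed neighbourhood of `x` and also `r` and `s`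
outside it, so its degree exceeds that of `x` by at least two. -/
theorem Light.far_center (h : Light (localCompletion G x) p r) (hp : G.Adj x p)
    (hr : ¬ G.Adj x r) (hrx : r ≠ x) (hs : G.Adj p s) (hsr : s ≠ r) (hsx : ¬ G.Adj x s)
    (hs' : s ≠ x) : Far G x r := by
  classical
  refine ⟨hrx.symm, hr, ?_⟩
  have hpr : G.Adj p r := h.1.resolve_right fun h' => hr h'.2.2
  have h1 := deg_center_add_card_le (G := G) {r, s} hp (by
    simp only [Finset.mem_insert, Finset.mem_singleton, forall_eq_or_imp, forall_eq]
    exact ⟨⟨hpr, hrx, hr⟩, hs, hs', hsx⟩)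
  rw [Finset.card_pair hsr.symm] at h1
  have := deg_mono (le_localCompletion G x) r
  have := h.2
  omega

theorem Moderate.of_completion (h : Moderate (localCompletion G x) u w) : Moderate G u w := by
  have h1 := deg_mono (le_localCompletion G x) u
  have h2 := deg_mono (le_localCompletion G x) w
  refine ⟨fun huw => ?_, fun huw => ?_⟩
  · have := h.1 (Or.inl huw)
    omega
  · by_cases huw' : (localCompletion G x).Adj u w
    · obtain ⟨hne, hu, hw⟩ := huw'.resolve_left huw
      have h1 := deg_add_card_le (G := G) {w} hu (by simpa using ⟨hne.symm, hw, huw⟩)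
      have h2 := deg_add_card_le (G := G) {u} hw
        (by simpa using ⟨hne, hu, fun h => huw h.symm⟩)
      have := h.1 huw'
      simp only [Finset.card_singleton] at h1 h2
      omega
    · have := h.2 huw'
      omega

/-- The new edge `u w` accounts for a gain of two, and the missing edge to `z` for a third, which
exhausts the slack in `n + 3`. -/
theorem Moderate.far (h : Moderate (localCompletion G x) u w) (hne : u ≠ w) (hu : G.Adj x u)
    (hw : G.Adj x w) (huw : ¬ G.Adj u w) (hz : G.Adj x z) (hzu : z ≠ u) (hzw : z ≠ w)
    (hwz : ¬ G.Adj w z ∨ ¬ G.Adj u z) : Far G u w := by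
  classical
  refine ⟨hne, huw, ?_⟩
  have h0 := h.1 (Or.inr ⟨hne, hu, hw⟩)
  have h1 := deg_add_card_le (G := G) {w} hu (by simpa using ⟨hne.symm, hw, huw⟩)
  have h2 := deg_add_card_le (G := G) {u} hw (by simpa using ⟨hne, hu, fun h => huw h.symm⟩)
  simp only [Finset.card_singleton] at h1 h2
  rcases hwz with hwz | hwz
  · have h3 := deg_add_card_le (G := G) {u, z} hw (by
      simp only [Finset.mem_insert, Finset.mem_singleton, forall_eq_or_imp, forall_eq]
      exact ⟨⟨hne, hu, fun h => huw h.symm⟩, hzw, hz, hwz⟩)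
    rw [Finset.card_pair hzu.symm] at h3
    omega
  · have h3 := deg_add_card_le (G := G) {w, z} hu (by
      simp only [Finset.mem_insert, Finset.mem_singleton, forall_eq_or_imp, forall_eq]
      exact ⟨⟨hne.symm, hw, huw⟩, hzu, hz, hwz⟩)
    rw [Finset.card_pair hzw.symm] at h3
    omega

theorem Moderate.light (h : Moderate (localCompletion G x) u w) (huw : G.Adj u w)
    (hw : G.Adj x w) (hz : G.Adj x z) (hzw : z ≠ w) (hwz : ¬ G.Adj w z) : Light G u w := by
  refine ⟨huw, ?_⟩
  have h0 := h.1 (Or.inl huw)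
  have h1 := deg_mono (le_localCompletion G x) u
  have h2 := deg_add_card_le (G := G) {z} hw (by simpa using ⟨hzw, hz, hwz⟩)
  simp only [Finset.card_singleton] at h2
  omega

theorem Moderate.far_center (h : Moderate (localCompletion G x) u w) (hw : G.Adj x w)
    (huw : ¬ (localCompletion G x).Adj u w) (hux : u ≠ x) (hu : ¬ G.Adj x u) (hs : G.Adj w s)
    (hsx : ¬ G.Adj x s) (hs' : s ≠ x) : Far G x u := by
  refine ⟨hux.symm, hu, ?_⟩
  have h0 := h.2 huw
  have h1 := deg_mono (le_localCompletion G x) u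
  have h2 := deg_center_add_card_le (G := G) {s} hw (by simpa using ⟨hs, hs', hsx⟩)
  simp only [Finset.card_singleton] at h2
  omega

end Basic

/-! ### Pulling back claws and `PatternQ` -/

section Stability

variable {V : Type*} [Fintype V]

/-- Every induced claw contains an `o`-heavy pair. -/
def NoClaw (G : SimpleGraph V) : Prop :=
  ∀ c u v w, G.Adj c u → G.Adj c v → G.Adj c w → Far G u v → Far G u w → Far G v w → False

/-- A light triangle `a₁ a₂ a₃` with pendant edges `a₂ b₂`, `a₃ b₃` and a pendant path `a₁ b₁ c`;
the pair `b₂, c` is unrestricted. -/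
structure PatternQ (G : SimpleGraph V) (a₁ a₂ a₃ b₁ b₂ b₃ c : V) : Prop where
  la₁₂ : Light G a₁ a₂
  la₁₃ : Light G a₁ a₃
  la₂₃ : Light G a₂ a₃
  lb₁ : Light G a₁ b₁
  eb₂ : G.Adj a₂ b₂
  eb₃ : G.Adj a₃ b₃
  ec : G.Adj b₁ c
  fa₁b₂ : Far G a₁ b₂
  fa₁b₃ : Far G a₁ b₃
  fa₁c : Far G a₁ c
  fa₂b₁ : Far G a₂ b₁
  fa₂b₃ : Far G a₂ b₃
  fa₂c : Far G a₂ c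
  fa₃b₁ : Far G a₃ b₁
  fa₃b₂ : Far G a₃ b₂
  fa₃c : Far G a₃ c
  fb₁₂ : Far G b₁ b₂
  fb₁₃ : Far G b₁ b₃
  fb₂₃ : Far G b₂ b₃
  fb₃c : Far G b₃ c

variable {G : SimpleGraph V} {x u v w p q r s : V}

theorem Far.not_adj (h : Far G u w) : ¬ G.Adj u w := h.2.1
theorem Far.ne (h : Far G u w) : u ≠ w := h.1
theorem Light.adj (h : Light G u w) : G.Adj u w := h.1

theorem Far.not_mem (h : Far (localCompletion G x) u w) (hu : G.Adj x u) : ¬ G.Adj x w :=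
  fun hw => h.2.1 (Or.inr ⟨h.1, hu, hw⟩)

theorem Far.ne_center (h : Far (localCompletion G x) u w) (hu : G.Adj x u) : w ≠ x := by
  rintro rfl
  exact h.2.1 (Or.inl hu.symm)

theorem NoClaw.localCompletion (hc : NoClaw G) (x : V) : NoClaw (localCompletion G x) := by
  -- If `c u` is new then `c` and `u` are neighbours of `x`, while `v` and `w`, being far from `u`,
  -- are not. So the other two edges are old and `x` replaces `u` in the claw.
  have key : ∀ c u v w, ¬ G.Adj c u → (HeavyPairs.localCompletion G x).Adj c u →
      (HeavyPairs.localCompletion G x).Adj c v →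
      (HeavyPairs.localCompletion G x).Adj c w → Far (HeavyPairs.localCompletion G x) u v →
      Far (HeavyPairs.localCompletion G x) u w → Far (HeavyPairs.localCompletion G x) v w →
      False := by
    intro c u v w hcu hu hv hw huv huw hvw
    obtain ⟨-, hc', hu'⟩ := hu.resolve_left hcu
    exact hc c x v w hc'.symm (hv.resolve_right fun h => huv.not_mem hu' h.2.2)
      (hw.resolve_right fun h => huw.not_mem hu' h.2.2) (huv.center hu') (huw.center hu')
      hvw.of_completion
  intro c u v w hu hv hw huv huw hvw
  by_cases h1 : G.Adj c u
  · by_cases h2 : G.Adj c v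
    · by_cases h3 : G.Adj c w
      · exact hc c u v w h1 h2 h3 huv.of_completion huw.of_completion hvw.of_completion
      · exact key c w u v h3 hw hu hv huw.symm hvw.symm huv
    · exact key c v u w h2 hv hu hw huv.symm hvw huw
  · exact key c u v w h1 hu hv hw huv huw hvw

/-- Otherwise `p` is the centre of a claw of `G` with leaves `x`, `r`, `s`. For a light triangle
with a suitable pendant edge, two vertices in the neighbourhood of `x` thus force the third into its
closed neighbourhood. -/
theorem NoClaw.triangle_closed (hc : NoClaw G) (hp : G.Adj x p) (hq : G.Adj x q)
    (hpr : Light (HeavyPairs.localCompletion G x) p r)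
    (hps : (HeavyPairs.localCompletion G x).Adj p s)
    (hsq : Far (HeavyPairs.localCompletion G x) s q)
    (hsr : Far (HeavyPairs.localCompletion G x) s r) : G.Adj x r ∨ r = x := by
  by_contra! h
  have hsx : ¬ G.Adj x s := hsq.symm.not_mem hq
  have hsx' : s ≠ x := hsq.symm.ne_center hq
  have hps' : G.Adj p s := hps.resolve_right fun h' => hsx h'.2.2
  have hpr' : G.Adj p r := hpr.1.resolve_right fun h' => h.1 h'.2.2
  exact hc p x r s hp.symm hpr' hps' (hpr.far_center hp h.1 h.2 hps' hsr.ne hsx hsx')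
    (hsq.symm.center hq) hsr.symm.of_completion

attribute [grind =] localCompletion_adj
attribute [grind →] Far.of_completion Far.symm Far.not_mem Far.ne_center
  Light.of_completion Light.symm Light.mem Light.far Far.not_adj Light.adj Far.center Light.center
attribute [grind =] SimpleGraph.adj_comm

theorem PatternQ.exists_of_localCompletion (hc : NoClaw G) {a₁ a₂ a₃ b₁ b₂ b₃ c : V}
    (h : PatternQ (localCompletion G x) a₁ a₂ a₃ b₁ b₂ b₃ c) :
    ∃ a₁ a₂ a₃ b₁ b₂ b₃ c : V, PatternQ G a₁ a₂ a₃ b₁ b₂ b₃ c := by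
  obtain ⟨la₁₂, la₁₃, la₂₃, lb₁, eb₂, eb₃, ec, fa₁b₂, fa₁b₃, fa₁c, fa₂b₁, fa₂b₃, fa₂c, fa₃b₁,
    fa₃b₂, fa₃c, fb₁₂, fb₁₃, fb₂₃, fb₃c⟩ := h
  -- When a pendant edge is new, both its ends are neighbours of `x`, and `x` replaces the outer
  -- end. If the first edge of the tail is new, the tail at `a₁` becomes `x`, `b₁`.
  by_cases h₁ : G.Adj a₃ b₃
  swap
  · exact ⟨a₁, a₂, a₃, b₁, b₂, x, c, by constructor <;> grind⟩
  by_cases h₂ : G.Adj a₂ b₂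
  swap
  · exact ⟨a₁, a₂, a₃, b₁, x, b₃, c, by constructor <;> grind⟩
  by_cases h₃ : G.Adj a₁ b₁
  swap
  · exact ⟨a₁, a₂, a₃, x, b₂, b₃, b₁, by constructor <;> grind⟩
  by_cases h₄ : G.Adj b₁ c
  swap
  · exact ⟨a₁, a₂, a₃, b₁, b₂, b₃, x, by constructor <;> grind⟩
  by_cases h₅ : G.Adj a₁ a₂ ∧ G.Adj a₁ a₃ ∧ G.Adj a₂ a₃
  · exact ⟨a₁, a₂, a₃, b₁, b₂, b₃, c, by constructor <;> grind⟩
  have x₁ : G.Adj x a₁ := by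
    by_contra hx
    have : G.Adj x a₂ ∧ G.Adj x a₃ := by grind
    have := hc.triangle_closed this.1 this.2 la₁₂.symm eb₂ fa₃b₂.symm fa₁b₂.symm
    grind
  have x₂ : G.Adj x a₂ := by
    by_contra hx
    have : G.Adj x a₁ ∧ G.Adj x a₃ := by grind
    have := hc.triangle_closed this.1 this.2 la₁₂ lb₁.1 fa₃b₁.symm fa₂b₁.symm
    grind
  have x₃ : G.Adj x a₃ := by
    by_contra hx
    have : G.Adj x a₁ ∧ G.Adj x a₂ := by grind
    have := hc.triangle_closed this.1 this.2 la₁₃ lb₁.1 fa₂b₁.symm fa₃b₁.symm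
    grind
  -- Now `x` sees the whole triangle and some edge of it is new. Two old edges give a claw at their
  -- common vertex, using its pendant edge; no old edge gives a claw at `x`; a single old edge spans
  -- a triangle with `x`, the third vertex becoming pendant at `x`.
  by_cases h₁₂ : G.Adj a₁ a₂
  · by_cases h₁₃ : G.Adj a₁ a₃
    · exact (hc a₁ a₂ a₃ b₁ h₁₂ h₁₃ h₃ (by grind) (by grind) (by grind)).elim
    · by_cases h₂₃ : G.Adj a₂ a₃
      · exact (hc a₂ a₁ a₃ b₂ h₁₂.symm h₂₃ h₂ (by grind) (by grind) (by grind)).elim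
      · exact ⟨a₁, a₂, x, b₁, b₂, a₃, c, by constructor <;> grind⟩
  · by_cases h₁₃ : G.Adj a₁ a₃
    · by_cases h₂₃ : G.Adj a₂ a₃
      · exact (hc a₃ a₁ a₂ b₃ h₁₃.symm h₂₃.symm h₁ (by grind) (by grind) (by grind)).elim
      · exact ⟨a₁, x, a₃, b₁, a₂, b₃, c, by constructor <;> grind⟩
    · by_cases h₂₃ : G.Adj a₂ a₃
      · exact ⟨x, a₂, a₃, a₁, b₂, b₃, b₁, by constructor <;> grind⟩
      · exact (hc x a₁ a₂ a₃ x₁ x₂ x₃ (by grind) (by grind) (by grind)).elim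

end Stability

/-! ### Pulling back `PatternF` -/

section Stability

variable {V : Type*} [Fintype V]

/-- Two light triangles `a₁ a₂ a₃` and `a₁ b p` sharing a vertex, with pendant edges `p d`,
`a₂ b₂` and `a₃ b₃`; the pairs `b₂, d`, `b₂, p` and `d, a₂` are unrestricted, and `b₂ = d` is
allowed. -/
structure PatternF (G : SimpleGraph V) (a₁ a₂ a₃ b p d b₂ b₃ : V) : Prop where
  la₁₂ : Light G a₁ a₂
  la₁₃ : Light G a₁ a₃
  la₂₃ : Light G a₂ a₃
  lb : Light G a₁ b
  lp : Light G a₁ p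
  lbp : Light G b p
  ed : G.Adj p d
  eb₂ : G.Adj a₂ b₂
  eb₃ : G.Adj a₃ b₃
  fa₁d : Far G a₁ d
  fa₁b₂ : Far G a₁ b₂
  fa₁b₃ : Far G a₁ b₃
  fa₂b : Far G a₂ b
  fa₂p : Far G a₂ p
  fa₂b₃ : Far G a₂ b₃
  fa₃b : Far G a₃ b
  fa₃p : Far G a₃ p
  fa₃d : Far G a₃ d
  fa₃b₂ : Far G a₃ b₂
  fbd : Far G b d
  fbb₂ : Far G b b₂
  fbb₃ : Far G b b₃
  fpb₃ : Far G p b₃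
  fdb₃ : Far G d b₃
  fb₂₃ : Far G b₂ b₃

variable {G : SimpleGraph V} {x : V}

set_option maxHeartbeats 1600000 in
theorem PatternF.exists_of_localCompletion (hc : NoClaw G) {a₁ a₂ a₃ b p d b₂ b₃ : V}
    (h : PatternF (localCompletion G x) a₁ a₂ a₃ b p d b₂ b₃) :
    (∃ a₁ a₂ a₃ b p d b₂ b₃ : V, PatternF G a₁ a₂ a₃ b p d b₂ b₃) ∨
      ∃ a₁ a₂ a₃ b₁ b₂ b₃ c : V, PatternQ G a₁ a₂ a₃ b₁ b₂ b₃ c := by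
  obtain ⟨la₁₂, la₁₃, la₂₃, lb, lp, lbp, ed, eb₂, eb₃, fa₁d, fa₁b₂, fa₁b₃, fa₂b, fa₂p, fa₂b₃,
    fa₃b, fa₃p, fa₃d, fa₃b₂, fbd, fbb₂, fbb₃, fpb₃, fdb₃, fb₂₃⟩ := h
  by_cases h₁ : G.Adj a₃ b₃
  swap
  · exact Or.inl ⟨a₁, a₂, a₃, b, p, d, b₂, x, by constructor <;> grind⟩
  by_cases h₂ : G.Adj a₂ b₂
  swap
  · exact Or.inl ⟨a₁, a₂, a₃, b, p, d, x, b₃, by constructor <;> grind⟩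
  by_cases h₃ : G.Adj p d
  swap
  · exact Or.inl ⟨a₁, a₂, a₃, b, p, x, b₂, b₃, by constructor <;> grind⟩
  by_cases h₄ : G.Adj a₁ b ∧ G.Adj a₁ p ∧ G.Adj b p
  · by_cases h₅ : G.Adj a₁ a₂ ∧ G.Adj a₁ a₃ ∧ G.Adj a₂ a₃
    · exact Or.inl ⟨a₁, a₂, a₃, b, p, d, b₂, b₃, by constructor <;> grind⟩
    have x₁ : G.Adj x a₁ := by
      by_contra hx
      have : G.Adj x a₂ ∧ G.Adj x a₃ := by grind
      have := hc.triangle_closed this.1 this.2 la₁₂.symm eb₂ fa₃b₂.symm fa₁b₂.symm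
      grind
    have x₂ : G.Adj x a₂ := by
      by_contra hx
      have : G.Adj x a₁ ∧ G.Adj x a₃ := by grind
      have := hc.triangle_closed this.1 this.2 la₁₂ lb.1 fa₃b.symm fa₂b.symm
      grind
    have x₃ : G.Adj x a₃ := by
      by_contra hx
      have : G.Adj x a₁ ∧ G.Adj x a₂ := by grind
      have := hc.triangle_closed this.1 this.2 la₁₃ lb.1 fa₂b.symm fa₃b.symm
      grind
    by_cases h₁₂ : G.Adj a₁ a₂
    · by_cases h₁₃ : G.Adj a₁ a₃
      · exact (hc a₁ a₂ a₃ b h₁₂ h₁₃ h₄.1 (by grind) (by grind) (by grind)).elim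
      · by_cases h₂₃ : G.Adj a₂ a₃
        · exact (hc a₂ a₁ a₃ b₂ h₁₂.symm h₂₃ h₂ (by grind) (by grind) (by grind)).elim
        · exact Or.inl ⟨a₁, a₂, x, b, p, d, b₂, a₃, by constructor <;> grind⟩
    · by_cases h₁₃ : G.Adj a₁ a₃
      · by_cases h₂₃ : G.Adj a₂ a₃
        · exact (hc a₃ a₁ a₂ b₃ h₁₃.symm h₂₃.symm h₁ (by grind) (by grind) (by grind)).elim
        · exact Or.inl ⟨a₁, x, a₃, b, p, d, a₂, b₃, by constructor <;> grind⟩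
      · by_cases h₂₃ : G.Adj a₂ a₃
        · exact Or.inr ⟨x, a₂, a₃, a₁, b₂, b₃, b, by constructor <;> grind⟩
        · exact (hc x a₁ a₂ a₃ x₁ x₂ x₃ (by grind) (by grind) (by grind)).elim
  -- Only one of the two triangles can lose an edge: otherwise `x` would see one of `a₂`, `a₃` and
  -- one of `b`, `p`, making a far pair adjacent in the completion.
  · have g₁ : G.Adj a₁ a₂ ∧ G.Adj a₁ a₃ ∧ G.Adj a₂ a₃ := by grind
    have x₁ : G.Adj x a₁ := by
      by_contra hx
      have : G.Adj x b ∧ G.Adj x p := by grind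
      have := hc.triangle_closed this.2 this.1 lp.symm ed fbd.symm fa₁d.symm
      grind
    have xp : G.Adj x p := by
      by_contra hx
      have : G.Adj x a₁ ∧ G.Adj x b := by grind
      have := hc.triangle_closed this.1 this.2 lp la₁₃.1 fa₃b fa₃p
      grind
    have xb : G.Adj x b ∨ b = x :=
      hc.triangle_closed x₁ xp lb la₁₃.1 fa₃p fa₃b
    by_cases k₁ : G.Adj a₁ p
    · have xb : G.Adj x b := by grind
      by_cases k₂ : G.Adj a₁ b
      · exact (hc a₁ b p a₃ k₂ k₁ g₁.2.1 (by grind) (by grind) (by grind)).elim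
      · by_cases k₃ : G.Adj b p
        · exact (hc p a₁ b d k₁.symm k₃.symm h₃ (by grind) (by grind) (by grind)).elim
        · exact Or.inl ⟨a₁, a₂, a₃, x, p, d, b₂, b₃, by constructor <;> grind⟩
    · by_cases k₂ : G.Adj a₁ b
      · by_cases k₃ : G.Adj b p
        · exact Or.inr ⟨a₁, a₂, a₃, b, b₂, b₃, p, by constructor <;> grind⟩
        · have xb : G.Adj x b := by grind
          exact Or.inl ⟨a₁, a₂, a₃, b, x, p, b₂, b₃, by constructor <;> grind⟩
      · have xb : G.Adj x b := by grind
        by_cases k₃ : G.Adj b p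
        · exact Or.inr ⟨a₁, a₂, a₃, x, b₂, b₃, b, by constructor <;> grind⟩
        · exact (hc x a₁ b p x₁ xb xp (by grind) (by grind) (by grind)).elim

end Stability

/-! ### Pulling back `PatternY` -/

section Stability

variable {V : Type*} [Fintype V]

/-- A complete graph `a₁ a₂ a₃ a₄`, light except for `a₁ a₄`, with pendant edges `a₁ b₁`, `a₂ b₂`
and a pendant path `a₃ b₃ c`; the pairs `c, a₁` and `c, b₁` are unrestricted. -/
structure PatternY (G : SimpleGraph V) (a₁ a₂ a₃ a₄ b₁ b₂ b₃ c : V) : Prop where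
  la₁₂ : Light G a₁ a₂
  la₁₃ : Light G a₁ a₃
  la₂₃ : Light G a₂ a₃
  la₂₄ : Light G a₂ a₄
  la₃₄ : Light G a₃ a₄
  ea₁₄ : G.Adj a₁ a₄
  eb₁ : G.Adj a₁ b₁
  eb₂ : G.Adj a₂ b₂
  lb₃ : Light G a₃ b₃
  ec : G.Adj b₃ c
  fa₁b₂ : Far G a₁ b₂
  fa₁b₃ : Far G a₁ b₃
  fa₂b₁ : Far G a₂ b₁
  fa₂b₃ : Far G a₂ b₃
  fa₂c : Far G a₂ c
  fa₃b₁ : Far G a₃ b₁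
  fa₃b₂ : Far G a₃ b₂
  fa₃c : Far G a₃ c
  fa₄b₁ : Far G a₄ b₁
  fa₄b₂ : Far G a₄ b₂
  fa₄b₃ : Far G a₄ b₃
  fa₄c : Far G a₄ c
  fb₁₂ : Far G b₁ b₂
  fb₁₃ : Far G b₁ b₃
  fb₂₃ : Far G b₂ b₃
  fb₂c : Far G b₂ c

variable {G : SimpleGraph V} {x : V}

set_option maxHeartbeats 1600000 in
theorem PatternY.exists_of_localCompletion (hc : NoClaw G) {a₁ a₂ a₃ a₄ b₁ b₂ b₃ c : V}
    (h : PatternY (localCompletion G x) a₁ a₂ a₃ a₄ b₁ b₂ b₃ c) :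
    (∃ a₁ a₂ a₃ a₄ b₁ b₂ b₃ c : V, PatternY G a₁ a₂ a₃ a₄ b₁ b₂ b₃ c) ∨
      ∃ a₁ a₂ a₃ b₁ b₂ b₃ c : V, PatternQ G a₁ a₂ a₃ b₁ b₂ b₃ c := by
  obtain ⟨la₁₂, la₁₃, la₂₃, la₂₄, la₃₄, ea₁₄, eb₁, eb₂, lb₃, ec, fa₁b₂, fa₁b₃, fa₂b₁, fa₂b₃,
    fa₂c, fa₃b₁, fa₃b₂, fa₃c, fa₄b₁, fa₄b₂, fa₄b₃, fa₄c, fb₁₂, fb₁₃, fb₂₃, fb₂c⟩ := h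
  by_cases h₁ : G.Adj a₁ b₁
  swap
  · exact Or.inl ⟨a₁, a₂, a₃, a₄, x, b₂, b₃, c, by constructor <;> grind⟩
  by_cases h₂ : G.Adj a₂ b₂
  swap
  · exact Or.inl ⟨a₁, a₂, a₃, a₄, b₁, x, b₃, c, by constructor <;> grind⟩
  by_cases h₃ : G.Adj a₃ b₃
  swap
  · exact Or.inl ⟨a₁, a₂, a₃, a₄, b₁, b₂, x, b₃, by constructor <;> grind⟩
  by_cases h₄ : G.Adj b₃ c
  swap
  · exact Or.inl ⟨a₁, a₂, a₃, a₄, b₁, b₂, b₃, x, by constructor <;> grind⟩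
  by_cases h₅ : G.Adj a₁ a₂ ∧ G.Adj a₁ a₃ ∧ G.Adj a₂ a₃ ∧ G.Adj a₁ a₄ ∧ G.Adj a₂ a₄ ∧ G.Adj a₃ a₄
  · exact Or.inl ⟨a₁, a₂, a₃, a₄, b₁, b₂, b₃, c, by constructor <;> grind⟩
  have t₁₂ : G.Adj x a₁ → G.Adj x a₂ → G.Adj x a₃ := fun y₁ y₂ => by
    have := hc.triangle_closed y₁ y₂ la₁₃ eb₁ fa₂b₁.symm fa₃b₁.symm
    grind
  have t₁₃ : G.Adj x a₁ → G.Adj x a₃ → G.Adj x a₂ := fun y₁ y₂ => by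
    have := hc.triangle_closed y₁ y₂ la₁₂ eb₁ fa₃b₁.symm fa₂b₁.symm
    grind
  have t₂₃ : G.Adj x a₂ → G.Adj x a₃ → G.Adj x a₁ := fun y₁ y₂ => by
    have := hc.triangle_closed y₁ y₂ la₁₂.symm eb₂ fa₃b₂.symm fa₁b₂.symm
    grind
  have t₄ : G.Adj x a₂ → G.Adj x a₃ → G.Adj x a₄ ∨ a₄ = x := fun y₁ y₂ =>
    hc.triangle_closed y₁ y₂ la₂₄ eb₂ fa₃b₂.symm fa₄b₂.symm
  have t₂₄ : G.Adj x a₂ → G.Adj x a₄ → G.Adj x a₁ := fun y₁ y₂ => by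
    have := hc.triangle_closed y₁ y₂ la₁₂.symm eb₂ fa₄b₂.symm fa₁b₂.symm
    grind
  have t₃₄ : G.Adj x a₃ → G.Adj x a₄ → G.Adj x a₁ := fun y₁ y₂ => by
    have := hc.triangle_closed y₁ y₂ la₁₃.symm lb₃.1 fa₄b₃.symm fa₁b₃.symm
    grind
  have t₁₄ : G.Adj x a₁ → G.Adj x a₄ → G.Adj x a₂ := fun y₁ y₂ => by
    have := hc.triangle_closed y₁ y₂ la₁₂ eb₁ fa₄b₁.symm fa₂b₁.symm
    grind
  -- Some edge of the complete graph is new, so `x` sees two of its vertices; the closure rules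
  -- above spread this to all four, except that `a₄` may be `x` itself.
  have hx : G.Adj x a₁ ∧ G.Adj x a₂ ∧ G.Adj x a₃ ∧ (G.Adj x a₄ ∨ a₄ = x) := by grind
  clear t₁₂ t₁₃ t₂₃ t₄ t₂₄ t₃₄ t₁₄
  obtain ⟨x₁, x₂, x₃, x₄⟩ := hx
  have lx₂ : Light G x a₂ := la₁₂.center x₁ x₂
  have lx₃ : Light G x a₃ := la₁₃.center x₁ x₃
  have lx₁ : Light G x a₁ := la₁₂.symm.center x₂ x₁
  have fx : ∀ y, Far (localCompletion G x) a₄ y → Far G x y := by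
    intro y hy
    rcases x₄ with h | rfl
    · exact hy.center h
    · exact hy.of_completion
  by_cases h₁₂ : G.Adj a₁ a₂
  · by_cases h₁₃ : G.Adj a₁ a₃
    · by_cases h₂₃ : G.Adj a₂ a₃
      -- Here only edges at `a₄` are new. This vertex has no pendant edge, so `x` can replace it.
      · exact Or.inl ⟨a₁, a₂, a₃, x, b₁, b₂, b₃, c, by constructor <;> grind⟩
      · exact (hc a₁ a₂ a₃ b₁ h₁₂ h₁₃ h₁ (by grind) (by grind) (by grind)).elim
    · by_cases h₂₃ : G.Adj a₂ a₃
      · exact (hc a₂ a₁ a₃ b₂ h₁₂.symm h₂₃ h₂ (by grind) (by grind) (by grind)).elim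
      · exact Or.inr ⟨x, a₁, a₂, a₃, b₁, b₂, b₃, by constructor <;> grind⟩
  · by_cases h₁₃ : G.Adj a₁ a₃
    · by_cases h₂₃ : G.Adj a₂ a₃
      · exact (hc a₃ a₁ a₂ b₃ h₁₃.symm h₂₃.symm h₃ (by grind) (by grind) (by grind)).elim
      · exact Or.inr ⟨x, a₁, a₃, a₂, b₁, b₃, b₂, by constructor <;> grind⟩
    · by_cases h₂₃ : G.Adj a₂ a₃
      · exact Or.inr ⟨a₃, x, a₂, b₃, a₁, b₂, c, by constructor <;> grind⟩
      · exact (hc x a₁ a₂ a₃ x₁ x₂ x₃ (by grind) (by grind) (by grind)).elim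

end Stability

/-! ### Pulling back `PatternZ` and `PatternNet` -/

section Stability

variable {V : Type*} [Fintype V]

/-- A light triangle `v p q` with a pendant edge `p b₂` and a pendant path `q b₃ t`, and a vertex
`a` adjacent to `v`, to at least one of `p` and `q`, and to `e₂` and `e₃`. -/
structure PatternZ (G : SimpleGraph V) (v p q a b₂ b₃ t e₂ e₃ : V) : Prop where
  lvp : Light G v p
  lvq : Light G v q
  lpq : Light G p q
  lva : Light G v a
  eapq : G.Adj a p ∨ G.Adj a q
  map : Moderate G a p
  maq : Moderate G a q
  eb₂ : G.Adj p b₂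
  lb₃ : Light G q b₃
  et : G.Adj b₃ t
  ee₂ : G.Adj a e₂
  ee₃ : G.Adj a e₃
  fvb₂ : Far G v b₂
  fvb₃ : Far G v b₃
  fvt : Far G v t
  fve₂ : Far G v e₂
  fve₃ : Far G v e₃
  fpb₃ : Far G p b₃
  fpt : Far G p t
  fpe₂ : Far G p e₂
  fpe₃ : Far G p e₃
  fqb₂ : Far G q b₂
  fqt : Far G q t
  fqe₂ : Far G q e₂
  fqe₃ : Far G q e₃
  fab₂ : Far G a b₂
  fab₃ : Far G a b₃
  fb₂₃ : Far G b₂ b₃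
  fb₂t : Far G b₂ t
  fb₂e₃ : Far G b₂ e₃
  fb₃e₂ : Far G b₃ e₂

variable {G : SimpleGraph V} {x : V}

attribute [grind →] Moderate.of_completion

set_option maxHeartbeats 3200000 in
theorem PatternZ.exists_of_localCompletion (hc : NoClaw G) {v p q a b₂ b₃ t e₂ e₃ : V}
    (h : PatternZ (localCompletion G x) v p q a b₂ b₃ t e₂ e₃) :
    (∃ v p q a b₂ b₃ t e₂ e₃ : V, PatternZ G v p q a b₂ b₃ t e₂ e₃) ∨
      ∃ a₁ a₂ a₃ b₁ b₂ b₃ c : V, PatternQ G a₁ a₂ a₃ b₁ b₂ b₃ c := by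
  obtain ⟨lvp, lvq, lpq, lva, eapq, map, maq, eb₂, lb₃, et, ee₂, ee₃, fvb₂, fvb₃, fvt, fve₂, fve₃,
    fpb₃, fpt, fpe₂, fpe₃, fqb₂, fqt, fqe₂, fqe₃, fab₂, fab₃, fb₂₃, fb₂t, fb₂e₃, fb₃e₂⟩ := h
  by_cases h₁ : G.Adj p b₂
  swap
  · exact Or.inl ⟨v, p, q, a, x, b₃, t, e₂, e₃, by constructor <;> grind⟩
  by_cases h₂ : G.Adj q b₃
  swap
  · exact Or.inl ⟨v, p, q, a, b₂, x, b₃, e₂, e₃, by constructor <;> grind⟩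
  by_cases h₃ : G.Adj b₃ t
  swap
  · exact Or.inl ⟨v, p, q, a, b₂, b₃, x, e₂, e₃, by constructor <;> grind⟩
  by_cases h₄ : G.Adj a e₂
  swap
  · by_cases h₅ : G.Adj a e₃
    · exact Or.inl ⟨v, p, q, a, b₂, b₃, t, x, e₃, by constructor <;> grind⟩
    -- Nothing in the pattern separates `e₂` from `e₃`, so `x` can play both roles.
    · exact Or.inl ⟨v, p, q, a, b₂, b₃, t, x, x, by constructor <;> grind⟩
  by_cases h₅ : G.Adj a e₃
  swap
  · exact Or.inl ⟨v, p, q, a, b₂, b₃, t, e₂, x, by constructor <;> grind⟩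
  by_cases g : G.Adj v p ∧ G.Adj v q ∧ G.Adj p q ∧ G.Adj v a ∧ (G.Adj a p ∨ G.Adj a q)
  · exact Or.inl ⟨v, p, q, a, b₂, b₃, t, e₂, e₃, by constructor <;> grind⟩
  have tpq : G.Adj x p → G.Adj x q → G.Adj x v ∨ v = x := fun h h' =>
    hc.triangle_closed h h' lvp.symm eb₂ fqb₂.symm fvb₂.symm
  have tpv : G.Adj x p → G.Adj x v → G.Adj x q := fun h h' => by
    have := hc.triangle_closed h h' lpq eb₂ fvb₂.symm fqb₂.symm
    grind
  have tqv : G.Adj x q → G.Adj x v → G.Adj x p := fun h h' => by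
    have := hc.triangle_closed h h' lpq.symm lb₃.1 fvb₃.symm fpb₃.symm
    grind
  have tpa : G.Adj x p → G.Adj x a → G.Adj x v ∨ v = x := fun h h' =>
    hc.triangle_closed h h' lvp.symm eb₂ fab₂.symm fvb₂.symm
  have tqa : G.Adj x q → G.Adj x a → G.Adj x v ∨ v = x := fun h h' =>
    hc.triangle_closed h h' lvq.symm lb₃.1 fab₃.symm fvb₃.symm
  have tva : G.Adj x v → G.Adj x a → G.Adj x p := by
    intro hv ha
    -- With `p` and `q` outside, `v` sees two vertices beyond the closed neighbourhood of `x`, so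
    -- `x` is far from both. One of them, with `x` and `e₂`, forms a claw at `a`.
    by_contra hp
    have hq : ¬ G.Adj x q := fun h => hp (tqv h hv)
    have hpx : p ≠ x := by grind
    have hqx : q ≠ x := by grind
    have hvp : G.Adj v p := by grind
    have hvq : G.Adj v q := by grind
    rcases eapq with h | h
    · exact hc a x p e₂ ha.symm (by grind) h₄
        (lvp.far_center hv hp hpx hvq lpq.1.ne' hq hqx) (by grind) (by grind)
    · exact hc a x q e₂ ha.symm (by grind) h₄
        (lvq.far_center hv hq hqx hvp lpq.1.ne hp hpx) (by grind) (by grind)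
  have hx : G.Adj x p ∧ G.Adj x q ∧ (G.Adj x v ∨ v = x) := by grind
  clear tpq tpv tqv tpa tqa tva
  obtain ⟨xp, xq, xv⟩ := hx
  have lxp : Light G x p := lpq.symm.center xq xp
  have lxq : Light G x q := lpq.center xp xq
  have fx : ∀ y, Far (localCompletion G x) v y → Far G x y := by
    intro y hy
    rcases xv with h | rfl
    · exact hy.center h
    · exact hy.of_completion
  -- If `x` sees `a`, then `x` can replace `v`, or a missing edge among `a`, `p`, `q` yields a claw
  -- or `PatternQ`. If not, then `v` is a proper neighbour of `x` and the edges from `a` to `p` and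
  -- `q` are unaffected by the completion.
  by_cases xa : G.Adj x a
  · have lxa : Light G x a := by
      rcases xv with h | rfl
      · exact lva.center h xa
      · exact lva.of_completion xa
    by_cases hpq : G.Adj p q
    · by_cases hap : ¬ G.Adj a p ∧ ¬ G.Adj a q
      · have fap : Far G a p := map.far (by grind) xa xp hap.1 xq (by grind) (by grind)
          (Or.inr hap.2)
        have faq : Far G a q := maq.far (by grind) xa xq hap.2 xp (by grind) (by grind)
          (Or.inr hap.1)
        exact Or.inr ⟨q, x, p, b₃, a, b₂, t, by constructor <;> grind⟩
      · exact Or.inl ⟨x, p, q, a, b₂, b₃, t, e₂, e₃, by constructor <;> grind⟩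
    · have hpq' : p ≠ q := lpq.1.ne
      have hap' : a ≠ p := by grind
      have haq' : a ≠ q := by grind
      by_cases hap : G.Adj a p
      · by_cases haq : G.Adj a q
        · exact (hc a p q e₂ hap haq h₄ (by grind) (by grind) (by grind)).elim
        · have lap : Light G a p := map.light hap xp xq hpq'.symm hpq
          have faq : Far G a q := maq.far haq' xa xq haq xp hap'.symm hpq'
            (Or.inl fun h => hpq h.symm)
          exact Or.inr ⟨x, a, p, q, e₃, b₂, b₃, by constructor <;> grind⟩
      · have fap : Far G a p := map.far hap' xa xp hap xq haq'.symm hpq'.symm (Or.inl hpq)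
        by_cases haq : G.Adj a q
        · have laq : Light G a q := maq.light haq xq xp hpq' fun h => hpq h.symm
          exact Or.inr ⟨x, a, q, p, e₂, b₃, b₂, by constructor <;> grind⟩
        · have faq : Far G a q := maq.far haq' xa xq haq xp hap'.symm hpq'
            (Or.inl fun h => hpq h.symm)
          exact (hc x a p q xa xp xq fap faq (by grind)).elim
  · have xv : G.Adj x v := by grind
    have hax : a ≠ x := by grind
    by_cases hpq : G.Adj p q
    · by_cases hvp : G.Adj v p
      · exact (hc p v q b₂ hvp.symm hpq h₁ (by grind) (by grind) (by grind)).elim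
      · by_cases hvq : G.Adj v q
        · exact (hc q v p b₃ hvq.symm hpq.symm h₂ (by grind) (by grind) (by grind)).elim
        · exact Or.inr ⟨q, x, p, b₃, v, b₂, t, by constructor <;> grind⟩
    · by_cases hap : G.Adj a p
      · by_cases haq : G.Adj a q
        · exact (hc a p q e₂ hap haq h₄ (by grind) (by grind) (by grind)).elim
        · have fxa : Far G x a := maq.far_center xq (by grind) hax xa h₂ (by grind) (by grind)
          exact (hc p x a b₂ xp.symm hap.symm h₁ fxa (by grind) (by grind)).elim
      · have haq : G.Adj a q := by grind
        have fxa : Far G x a := map.far_center xp (by grind) hax xa h₁ (by grind) (by grind)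
        exact (hc q x a b₃ xq.symm haq.symm h₂ fxa (by grind) (by grind)).elim

/-- An induced net with a light triangle and without `o`-heavy pairs. -/
structure PatternNet (G : SimpleGraph V) (a₁ a₂ a₃ b₁ b₂ b₃ : V) : Prop where
  la₁₂ : Light G a₁ a₂
  la₁₃ : Light G a₁ a₃
  la₂₃ : Light G a₂ a₃
  eb₁ : G.Adj a₁ b₁
  eb₂ : G.Adj a₂ b₂
  eb₃ : G.Adj a₃ b₃
  fa₁b₂ : Far G a₁ b₂
  fa₁b₃ : Far G a₁ b₃
  fa₂b₁ : Far G a₂ b₁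
  fa₂b₃ : Far G a₂ b₃
  fa₃b₁ : Far G a₃ b₁
  fa₃b₂ : Far G a₃ b₂
  fb₁₂ : Far G b₁ b₂
  fb₁₃ : Far G b₁ b₃
  fb₂₃ : Far G b₂ b₃

set_option maxHeartbeats 1600000 in
theorem PatternNet.exists_of_localCompletion (hc : NoClaw G) {a₁ a₂ a₃ b₁ b₂ b₃ : V}
    (h : PatternNet (localCompletion G x) a₁ a₂ a₃ b₁ b₂ b₃) :
    ∃ a₁ a₂ a₃ b₁ b₂ b₃ : V, PatternNet G a₁ a₂ a₃ b₁ b₂ b₃ := by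
  obtain ⟨la₁₂, la₁₃, la₂₃, eb₁, eb₂, eb₃, fa₁b₂, fa₁b₃, fa₂b₁, fa₂b₃, fa₃b₁, fa₃b₂, fb₁₂, fb₁₃,
    fb₂₃⟩ := h
  by_cases h₁ : G.Adj a₁ b₁
  swap
  · exact ⟨a₁, a₂, a₃, x, b₂, b₃, by constructor <;> grind⟩
  by_cases h₂ : G.Adj a₂ b₂
  swap
  · exact ⟨a₁, a₂, a₃, b₁, x, b₃, by constructor <;> grind⟩
  by_cases h₃ : G.Adj a₃ b₃
  swap
  · exact ⟨a₁, a₂, a₃, b₁, b₂, x, by constructor <;> grind⟩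
  by_cases h₅ : G.Adj a₁ a₂ ∧ G.Adj a₁ a₃ ∧ G.Adj a₂ a₃
  · exact ⟨a₁, a₂, a₃, b₁, b₂, b₃, by constructor <;> grind⟩
  have x₁ : G.Adj x a₁ := by
    by_contra hx
    have : G.Adj x a₂ ∧ G.Adj x a₃ := by grind
    have := hc.triangle_closed this.1 this.2 la₁₂.symm eb₂ fa₃b₂.symm fa₁b₂.symm
    grind
  have x₂ : G.Adj x a₂ := by
    by_contra hx
    have : G.Adj x a₁ ∧ G.Adj x a₃ := by grind
    have := hc.triangle_closed this.1 this.2 la₁₂ eb₁ fa₃b₁.symm fa₂b₁.symm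
    grind
  have x₃ : G.Adj x a₃ := by
    by_contra hx
    have : G.Adj x a₁ ∧ G.Adj x a₂ := by grind
    have := hc.triangle_closed this.1 this.2 la₁₃ eb₁ fa₂b₁.symm fa₃b₁.symm
    grind
  by_cases h₁₂ : G.Adj a₁ a₂
  · by_cases h₁₃ : G.Adj a₁ a₃
    · exact (hc a₁ a₂ a₃ b₁ h₁₂ h₁₃ h₁ (by grind) (by grind) (by grind)).elim
    · by_cases h₂₃ : G.Adj a₂ a₃
      · exact (hc a₂ a₁ a₃ b₂ h₁₂.symm h₂₃ h₂ (by grind) (by grind) (by grind)).elim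
      · exact ⟨a₁, a₂, x, b₁, b₂, a₃, by constructor <;> grind⟩
  · by_cases h₁₃ : G.Adj a₁ a₃
    · by_cases h₂₃ : G.Adj a₂ a₃
      · exact (hc a₃ a₁ a₂ b₃ h₁₃.symm h₂₃.symm h₃ (by grind) (by grind) (by grind)).elim
      · exact ⟨a₁, x, a₃, b₁, a₂, b₃, by constructor <;> grind⟩
    · by_cases h₂₃ : G.Adj a₂ a₃
      · exact ⟨x, a₂, a₃, a₁, b₂, b₃, by constructor <;> grind⟩
      · exact (hc x a₁ a₂ a₃ x₁ x₂ x₃ (by grind) (by grind) (by grind)).elim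

end Stability

/-! ### Absence of the patterns from the original graph and from all completions -/

section Base

variable {V : Type*} [Fintype V] {G : SimpleGraph V}

theorem OHeavyFor.of_embedding {W W' : Type*} {S : SimpleGraph W} {S' : SimpleGraph W'}
    (h : OHeavyFor S G) (f : S ↪g S') : OHeavyFor S' G := fun φ => by
  obtain ⟨i, j, hij⟩ := h (φ.comp f)
  exact ⟨f i, f j, hij⟩

/-- An injective map that preserves and reflects adjacency, as an embedding. -/
def embeddingOf {W V : Type*} {S : SimpleGraph W} {G : SimpleGraph V} (f : W → V)
    (h : ∀ i j, i ≠ j → f i ≠ f j ∧ (G.Adj (f i) (f j) ↔ S.Adj i j)) : S ↪g G where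
  toFun := f
  inj' i j hij := by
    by_contra hne
    exact (h i j hne).1 hij
  map_rel_iff' {i j} := by
    by_cases hij : i = j
    · subst hij
      simp
    · exact (h i j hij).2

theorem OHeavyFor.false_of_far {W : Type*} {S : SimpleGraph W} (h : OHeavyFor S G) (f : W → V)
    (hf : ∀ i j, S.Adj i j → G.Adj (f i) (f j))
    (hf' : ∀ i j, i ≠ j → ¬ S.Adj i j → Far G (f i) (f j)) : False := by
  obtain ⟨i, j, hne, hadj, hdeg⟩ := h (embeddingOf f fun i j hij => by
    by_cases hS : S.Adj i j
    · exact ⟨(hf i j hS).ne, by simp [hS, hf i j hS]⟩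
    · exact ⟨(hf' i j hij hS).1, by simp [hS, (hf' i j hij hS).2.1]⟩)
  by_cases hij : i = j
  · subst hij
    exact hne rfl
  by_cases hS : S.Adj i j
  · exact hadj (hf i j hS)
  · exact absurd (hf' i j hij hS).2.2 (not_lt.2 hdeg)

theorem OHeavyFor.noClaw (h : OHeavyFor claw G) : NoClaw G := by
  intro c u v w hu hv hw huv huw hvw
  refine h.false_of_far (Sum.elim (fun _ => c) ![u, v, w]) ?_ ?_
  · rintro (i | i) (j | j) hij <;> fin_cases i <;> fin_cases j <;>
      simp_all [claw, SimpleGraph.adj_comm]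
  · rintro (i | i) (j | j) hne hij <;> fin_cases i <;> fin_cases j <;>
      simp_all [claw, Far.symm]

theorem OHeavyFor.false_of_path (h : OHeavyFor (P 5) G) {v₁ v₂ v₃ v₄ v₅ : V}
    (h₁₂ : G.Adj v₁ v₂) (h₂₃ : G.Adj v₂ v₃) (h₃₄ : G.Adj v₃ v₄) (h₄₅ : G.Adj v₄ v₅)
    (h₁₃ : Far G v₁ v₃) (h₁₄ : Far G v₁ v₄) (h₁₅ : Far G v₁ v₅) (h₂₄ : Far G v₂ v₄)
    (h₂₅ : Far G v₂ v₅) (h₃₅ : Far G v₃ v₅) : False := by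
  refine h.false_of_far ![v₁, v₂, v₃, v₄, v₅] ?_ ?_
  · intro i j hij
    fin_cases i <;> fin_cases j <;> simp_all [P, SimpleGraph.pathGraph_adj, SimpleGraph.adj_comm]
  · intro i j hne hij
    fin_cases i <;> fin_cases j <;> simp_all [P, SimpleGraph.pathGraph_adj, Far.symm]

theorem OHeavyFor.false_of_wounded (h : OHeavyFor wounded G) {v₀ v₁ v₂ v₃ v₄ v₅ : V}
    (h₀₁ : G.Adj v₀ v₁) (h₁₂ : G.Adj v₁ v₂) (h₀₂ : G.Adj v₀ v₂) (h₀₃ : G.Adj v₀ v₃)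
    (h₁₄ : G.Adj v₁ v₄) (h₄₅ : G.Adj v₄ v₅)
    (h₀₄ : Far G v₀ v₄) (h₀₅ : Far G v₀ v₅) (h₁₃ : Far G v₁ v₃) (h₁₅ : Far G v₁ v₅)
    (h₂₃ : Far G v₂ v₃) (h₂₄ : Far G v₂ v₄) (h₂₅ : Far G v₂ v₅) (h₃₄ : Far G v₃ v₄)
    (h₃₅ : Far G v₃ v₅) : False := by
  refine h.false_of_far ![v₀, v₁, v₂, v₃, v₄, v₅] ?_ ?_
  · intro i j hij
    fin_cases i <;> fin_cases j <;> simp_all [wounded, SimpleGraph.adj_comm]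
  · intro i j hne hij
    fin_cases i <;> fin_cases j <;> simp_all [wounded, Far.symm]

theorem OHeavyFor.false_of_net (h : OHeavyFor net G) {a₁ a₂ a₃ b₁ b₂ b₃ : V} :
    ¬ PatternNet G a₁ a₂ a₃ b₁ b₂ b₃ := by
  rintro ⟨la₁₂, la₁₃, la₂₃, eb₁, eb₂, eb₃, fa₁b₂, fa₁b₃, fa₂b₁, fa₂b₃, fa₃b₁, fa₃b₂, fb₁₂, fb₁₃,
    fb₂₃⟩
  have := la₁₂.1
  have := la₁₃.1
  have := la₂₃.1
  refine h.false_of_far (Sum.elim ![a₁, a₂, a₃] ![b₁, b₂, b₃]) ?_ ?_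
  · rintro (i | i) (j | j) hij <;> fin_cases i <;> fin_cases j <;>
      simp_all [net, SimpleGraph.adj_comm]
  · rintro (i | i) (j | j) hne hij <;> fin_cases i <;> fin_cases j <;>
      simp_all [net, Far.symm]

set_option maxHeartbeats 1600000 in
-- The condition is inherited by larger graphs under induced containment. The vectors list the
-- images of the vertices in `P 5` or `wounded`.
theorem oHeavyFor_path_or_net_or_wounded
    (hS : OHeavyFor (P 4) G ∨ OHeavyFor (P 5) G ∨ OHeavyFor C₃ G ∨ OHeavyFor (Z 1) G ∨
      OHeavyFor (Z 2) G ∨ OHeavyFor bull G ∨ OHeavyFor net G ∨ OHeavyFor wounded G) :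
    OHeavyFor net G ∨ OHeavyFor (P 5) G ∨ OHeavyFor wounded G := by
  rcases hS with h | h | h | h | h | h | h | h
  · refine Or.inr (Or.inl (h.of_embedding (embeddingOf ![0, 1, 2, 3] ?_)))
    clear h
    intro i j hij
    fin_cases i <;> fin_cases j <;> simp_all [P, SimpleGraph.pathGraph_adj]
  · exact Or.inr (Or.inl h)
  · refine Or.inr (Or.inr (h.of_embedding (embeddingOf ![0, 1, 2] ?_)))
    clear h
    intro i j hij
    fin_cases i <;> fin_cases j <;> simp_all [wounded, C₃, SimpleGraph.cycleGraph_adj] <;>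
      decide
  · refine Or.inr (Or.inr (h.of_embedding (embeddingOf ![1, 2, 0, 3] ?_)))
    clear h
    intro i j hij
    fin_cases i <;> fin_cases j <;>
      simp_all [wounded, Z, SimpleGraph.pathGraph_adj, SimpleGraph.edge_adj, Fin.ext_iff]
  · refine Or.inr (Or.inr (h.of_embedding (embeddingOf ![0, 2, 1, 4, 5] ?_)))
    clear h
    intro i j hij
    fin_cases i <;> fin_cases j <;>
      simp_all [wounded, Z, SimpleGraph.pathGraph_adj, SimpleGraph.edge_adj, Fin.ext_iff]
  · refine Or.inr (Or.inr (h.of_embedding (embeddingOf ![0, 1, 2, 3, 4] ?_)))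
    clear h
    intro i j hij
    fin_cases i <;> fin_cases j <;> simp_all [wounded, bull]
  · exact Or.inl h
  · exact Or.inr (Or.inr h)

/-- No pattern of the four kinds, and no light claw, occurs. -/
structure PatternFree (G : SimpleGraph V) : Prop where
  noClaw : NoClaw G
  noQ : ∀ a₁ a₂ a₃ b₁ b₂ b₃ c, ¬ PatternQ G a₁ a₂ a₃ b₁ b₂ b₃ c
  noF : ∀ a₁ a₂ a₃ b p d b₂ b₃, ¬ PatternF G a₁ a₂ a₃ b p d b₂ b₃
  noY : ∀ a₁ a₂ a₃ a₄ b₁ b₂ b₃ c, ¬ PatternY G a₁ a₂ a₃ a₄ b₁ b₂ b₃ c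
  noZ : ∀ v p q a b₂ b₃ t e₂ e₃, ¬ PatternZ G v p q a b₂ b₃ t e₂ e₃

/-- Every pattern contains an induced `P 5` and an induced `wounded` all of whose nonadjacent pairs
are `Far`; the unrestricted pairs are avoided. -/
theorem patternFree_of_oHeavyFor (hc : OHeavyFor claw G)
    (h : OHeavyFor (P 5) G ∨ OHeavyFor wounded G) : PatternFree G where
  noClaw := hc.noClaw
  noQ a₁ a₂ a₃ b₁ b₂ b₃ c hp := by
    obtain ⟨la₁₂, la₁₃, la₂₃, lb₁, eb₂, eb₃, ec, fa₁b₂, fa₁b₃, fa₁c, fa₂b₁, fa₂b₃, fa₂c, fa₃b₁,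
      fa₃b₂, fa₃c, fb₁₂, fb₁₃, fb₂₃, fb₃c⟩ := hp
    rcases h with h | h
    · exact h.false_of_path ec.symm lb₁.1.symm la₁₃.1 eb₃ fa₁c.symm fa₃c.symm fb₃c.symm
        fa₃b₁.symm fb₁₃ fa₁b₃
    · exact h.false_of_wounded la₁₃.1.symm la₁₂.1 la₂₃.1.symm eb₃ lb₁.1 ec fa₃b₁ fa₃c fa₁b₃ fa₁c
        fa₂b₃ fa₂b₁ fa₂c fb₁₃.symm fb₃c
  noF a₁ a₂ a₃ b p d b₂ b₃ hp := by
    obtain ⟨la₁₂, la₁₃, la₂₃, lb, lp, lbp, ed, eb₂, eb₃, fa₁d, fa₁b₂, fa₁b₃, fa₂b, fa₂p, fa₂b₃,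
      fa₃b, fa₃p, fa₃d, fa₃b₂, fbd, fbb₂, fbb₃, fpb₃, fdb₃, fb₂₃⟩ := hp
    rcases h with h | h
    · exact h.false_of_path ed.symm lp.1.symm la₁₃.1 eb₃ fa₁d.symm fa₃d.symm fdb₃ fa₃p.symm fpb₃
        fa₁b₃
    · exact h.false_of_wounded lp.1.symm lb.1 lbp.1.symm ed la₁₃.1 eb₃ fa₃p.symm fpb₃ fa₁d fa₁b₃
        fbd fa₃b.symm fbb₃ fa₃d.symm fdb₃
  noY a₁ a₂ a₃ a₄ b₁ b₂ b₃ c hp := by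
    obtain ⟨la₁₂, la₁₃, la₂₃, la₂₄, la₃₄, ea₁₄, eb₁, eb₂, lb₃, ec, fa₁b₂, fa₁b₃, fa₂b₁, fa₂b₃,
      fa₂c, fa₃b₁, fa₃b₂, fa₃c, fa₄b₁, fa₄b₂, fa₄b₃, fa₄c, fb₁₂, fb₁₃, fb₂₃, fb₂c⟩ := hp
    rcases h with h | h
    · exact h.false_of_path ec.symm lb₃.1.symm la₂₃.1.symm eb₂ fa₃c.symm fa₂c.symm fb₂c.symm
        fa₂b₃.symm fb₂₃.symm fa₃b₂
    · exact h.false_of_wounded la₂₃.1 la₃₄.1 la₂₄.1 eb₂ lb₃.1 ec fa₂b₃ fa₂c fa₃b₂ fa₃c fa₄b₂ fa₄b₃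
        fa₄c fb₂₃ fb₂c
  noZ v p q a b₂ b₃ t e₂ e₃ hp := by
    obtain ⟨lvp, lvq, lpq, lva, eapq, map, maq, eb₂, lb₃, et, ee₂, ee₃, fvb₂, fvb₃, fvt, fve₂,
      fve₃, fpb₃, fpt, fpe₂, fpe₃, fqb₂, fqt, fqe₂, fqe₃, fab₂, fab₃, fb₂₃, fb₂t, fb₂e₃, fb₃e₂⟩ :=
      hp
    rcases h with h | h
    · exact h.false_of_path eb₂.symm lpq.1 lb₃.1 et fqb₂.symm fb₂₃ fb₂t fpb₃ fpt fqt
    · exact h.false_of_wounded lpq.1 lvq.1.symm lvp.1.symm eb₂ lb₃.1 et fpb₃ fpt fqb₂ fqt fvb₂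
        fvb₃ fvt fb₂₃ fb₂t

theorem PatternFree.localCompletion (h : PatternFree G) (x : V) :
    PatternFree (localCompletion G x) where
  noClaw := h.noClaw.localCompletion x
  noQ _ _ _ _ _ _ _ hp := by
    obtain ⟨_, _, _, _, _, _, _, hq⟩ := hp.exists_of_localCompletion h.noClaw
    exact h.noQ _ _ _ _ _ _ _ hq
  noF _ _ _ _ _ _ _ _ hp := by
    rcases hp.exists_of_localCompletion h.noClaw with
      ⟨_, _, _, _, _, _, _, _, hq⟩ | ⟨_, _, _, _, _, _, _, hq⟩
    · exact h.noF _ _ _ _ _ _ _ _ hq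
    · exact h.noQ _ _ _ _ _ _ _ hq
  noY _ _ _ _ _ _ _ _ hp := by
    rcases hp.exists_of_localCompletion h.noClaw with
      ⟨_, _, _, _, _, _, _, _, hq⟩ | ⟨_, _, _, _, _, _, _, hq⟩
    · exact h.noY _ _ _ _ _ _ _ _ hq
    · exact h.noQ _ _ _ _ _ _ _ hq
  noZ _ _ _ _ _ _ _ _ _ hp := by
    rcases hp.exists_of_localCompletion h.noClaw with
      ⟨_, _, _, _, _, _, _, _, _, hq⟩ | ⟨_, _, _, _, _, _, _, hq⟩
    · exact h.noZ _ _ _ _ _ _ _ _ _ hq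
    · exact h.noQ _ _ _ _ _ _ _ hq

variable {H : SimpleGraph V}

theorem PatternFree.of_reflTransGen (h : PatternFree G) (hH : Relation.ReflTransGen CStep G H) :
    PatternFree H := by
  induction hH with
  | refl => exact h
  | tail _ hs ih =>
    obtain ⟨x, -, rfl⟩ := hs
    exact ih.localCompletion x

theorem noClaw_and_noNet_of_reflTransGen (hc : NoClaw G)
    (h : ∀ a₁ a₂ a₃ b₁ b₂ b₃, ¬ PatternNet G a₁ a₂ a₃ b₁ b₂ b₃)
    (hH : Relation.ReflTransGen CStep G H) :
    NoClaw H ∧ ∀ a₁ a₂ a₃ b₁ b₂ b₃, ¬ PatternNet H a₁ a₂ a₃ b₁ b₂ b₃ := by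
  induction hH with
  | refl => exact ⟨hc, h⟩
  | tail _ hs ih =>
    obtain ⟨x, -, rfl⟩ := hs
    refine ⟨ih.1.localCompletion x, fun _ _ _ _ _ _ hp => ?_⟩
    obtain ⟨_, _, _, _, _, _, hq⟩ := hp.exists_of_localCompletion ih.1
    exact ih.2 _ _ _ _ _ _ hq

theorem le_of_reflTransGen (hH : Relation.ReflTransGen CStep G H) : G ≤ H := by
  induction hH with
  | refl => exact le_rfl
  | tail _ hs ih => exact ih.trans hs.lt.le

theorem TwoConnected.mono (h : TwoConnected G) (hle : G ≤ H) : TwoConnected H :=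
  ⟨h.1, h.2.1.mono hle, fun v => (h.2.2 v).mono fun _ _ hab => hle hab⟩

end Base

/-! ### Graphs without `c`-eligible vertices -/

section Closed

variable {V : Type*} [Fintype V] {H : SimpleGraph V} {x u v w : V}

theorem far_of_not_bcGraph_adj (hu : H.Adj x u) (hv : H.Adj x v) (hne : u ≠ v)
    (h : ¬ (bcGraph H x).Adj u v) : Far H u v := by
  have h1 : ¬ H.Adj u v := fun h' => h (Or.inl h')
  exact ⟨hne, h1, lt_of_not_ge fun h' => h (Or.inr ⟨hu, hv, hne, h1, h'⟩)⟩

/-- At a vertex that is not `c`-eligible, the neighbourhood is a clique or splits into two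
cliques. -/
theorem NoClaw.exists_split (hc : NoClaw H) (hx : ¬ CEligible H x) (hu : H.Adj x u)
    (hv : H.Adj x v) (hne : u ≠ v) (huv : ¬ H.Adj u v) :
    ∃ C₁ C₂ : Set V, C₁ ∪ C₂ = H.neighborSet x ∧ Disjoint C₁ C₂ ∧ (bcGraph H x).IsClique C₁ ∧
      (∀ a ∈ C₁, ∀ b ∈ C₂, ¬ (bcGraph H x).Adj a b) ∧ u ∈ C₁ ∧ C₂.Nonempty ∧
      ∀ z, OHeavyPair H x z → ∀ y₁ ∈ C₁, ∀ y₂ ∈ C₂, H.Adj z y₁ → H.Adj z y₂ → False := by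
  have hncl : ¬ H.IsClique (H.neighborSet x) := fun h => huv (h hu hv hne)
  have hncon : ¬ ((bcGraph H x).induce (H.neighborSet x)).Connected := fun h =>
    hx ⟨hncl, Or.inl h⟩
  set K := (bcGraph H x).induce (H.neighborSet x) with hK
  have indep : ∀ a b c, H.Adj x a → H.Adj x b → H.Adj x c → a ≠ b → a ≠ c → b ≠ c →
      ¬ (bcGraph H x).Adj a b → ¬ (bcGraph H x).Adj a c → ¬ (bcGraph H x).Adj b c → False :=
    fun a b c ha hb hc' hab hac hbc h1 h2 h3 => hc x a b c ha hb hc'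
      (far_of_not_bcGraph_adj ha hb hab h1) (far_of_not_bcGraph_adj ha hc' hac h2)
      (far_of_not_bcGraph_adj hb hc' hbc h3)
  -- The component of `u` in the `bcGraph` neighbourhood, with `C₂` the rest. A nonadjacent pair
  -- inside one part, with a vertex of the other, would be an independent triple and hence a claw at
  -- `x`.
  let C₁ : Set V := {y | ∃ h : y ∈ H.neighborSet x, K.Reachable ⟨u, hu⟩ ⟨y, h⟩}
  let C₂ : Set V := {y | y ∈ H.neighborSet x ∧ y ∉ C₁}
  have hu₁ : u ∈ C₁ := ⟨hu, SimpleGraph.Reachable.refl _⟩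
  have hcross : ∀ a ∈ C₁, ∀ b ∈ C₂, ¬ (bcGraph H x).Adj a b := by
    rintro a ⟨ha, har⟩ b ⟨hb, hb'⟩ hab
    exact hb' ⟨hb, har.trans (SimpleGraph.Adj.reachable (G := K) hab)⟩
  have hdisj : Disjoint C₁ C₂ := Set.disjoint_left.2 fun a ha ha' => ha'.2 ha
  have hunion : C₁ ∪ C₂ = H.neighborSet x := by
    ext y
    constructor
    · rintro (⟨h, -⟩ | ⟨h, -⟩) <;> exact h
    · intro hy
      by_cases hy' : y ∈ C₁
      · exact Or.inl hy'
      · exact Or.inr ⟨hy, hy'⟩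
  have hC₂ : C₂.Nonempty := by
    by_contra hne
    refine hncon ((SimpleGraph.connected_iff_exists_forall_reachable _).2 ⟨⟨u, hu⟩, ?_⟩)
    rintro ⟨y, hy⟩
    by_contra hr
    exact hne ⟨y, hy, fun ⟨_, h⟩ => hr h⟩
  have hcl₁ : (bcGraph H x).IsClique C₁ := by
    intro a ha b hb hab
    by_contra hnab
    obtain ⟨c, hc'⟩ := hC₂
    exact indep a b c ha.1 hb.1 hc'.1 hab (fun h => hc'.2 (h ▸ ha)) (fun h => hc'.2 (h ▸ hb)) hnab
      (hcross a ha c hc') (hcross b hb c hc')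
  have hcl₂ : (bcGraph H x).IsClique C₂ := by
    intro a ha b hb hab
    by_contra hnab
    exact indep u a b hu ha.1 hb.1 (fun h => ha.2 (h ▸ hu₁)) (fun h => hb.2 (h ▸ hu₁)) hab
      (hcross u hu₁ a ha) (hcross u hu₁ b hb) hnab
  exact ⟨C₁, C₂, hunion, hdisj, hcl₁, hcross, hu₁, hC₂, fun z hz y₁ hy₁ y₂ hy₂ h₁ h₂ =>
    hx ⟨hncl, Or.inr ⟨C₁, C₂, ⟨hunion, hdisj, hcl₁, hcl₂, hcross⟩, z, hz, ⟨y₁, hy₁, h₁⟩,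
      ⟨y₂, hy₂, h₂⟩⟩⟩⟩

/-- Inclusion-exclusion: the union of the two neighbourhoods misses `u`, `v` and all of `O`, while
the degrees sum to at least the number of vertices. -/
theorem card_add_two_le_card_common (huv : OHeavyPair H u v) (M O : Finset V)
    (hM : ∀ w, w ∈ M ↔ H.Adj u w ∧ H.Adj v w)
    (hO : ∀ w, w ∈ O ↔ w ≠ u ∧ w ≠ v ∧ ¬ H.Adj u w ∧ ¬ H.Adj v w) : O.card + 2 ≤ M.card := by
  classical
  obtain ⟨hne, hadj, hdeg⟩ := huv
  set A := Finset.univ.filter fun w => H.Adj u w with hA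
  set B := Finset.univ.filter fun w => H.Adj v w with hB
  rw [deg_eq_card H u A (by simp [hA]), deg_eq_card H v B (by simp [hB])] at hdeg
  have h1 : (A ∩ B) = M := by
    ext w
    simp [hA, hB, hM]
  have h2 := Finset.card_union_add_card_inter A B
  have h3 : Disjoint (A ∪ B) O := by
    rw [Finset.disjoint_left]
    intro w hw hw'
    have := (hO w).1 hw'
    simp only [hA, hB, Finset.mem_union, Finset.mem_filter, Finset.mem_univ, true_and] at hw
    tauto
  have h4 : Disjoint ((A ∪ B) ∪ O) {u, v} := by
    rw [Finset.disjoint_right]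
    intro w hw hw'
    simp only [hA, hB, Finset.mem_union, Finset.mem_filter, Finset.mem_univ, true_and, hO] at hw'
    simp only [Finset.mem_insert, Finset.mem_singleton] at hw
    rcases hw with rfl | rfl
    · have := fun h : H.Adj v w => hadj h.symm
      simp_all
    · simp_all
  have h5 := Finset.card_le_univ (((A ∪ B) ∪ O) ∪ {u, v})
  rw [Finset.card_union_of_disjoint h4, Finset.card_union_of_disjoint h3,
    Finset.card_pair hne] at h5
  rw [h1] at h2
  omega

/-- A graph without `c`-eligible vertices all of whose claws contain an `o`-heavy pair has no
`o`-heavy pair at all. -/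
theorem NoClaw.not_oHeavyPair (hc : NoClaw H) (hx : ∀ x, ¬ CEligible H x) (u v : V) :
    ¬ OHeavyPair H u v := by
  classical
  intro huv
  set M := Finset.univ.filter fun w => H.Adj u w ∧ H.Adj v w with hM
  set O := Finset.univ.filter fun w => w ≠ u ∧ w ≠ v ∧ ¬ H.Adj u w ∧ ¬ H.Adj v w with hO
  have hcard := card_add_two_le_card_common huv M O (by simp [hM]) (by simp [hO])
  -- For a common neighbour `w`, the vertices `u` and `v` lie in one part of its neighbourhood; any
  -- `r` in the other part is adjacent to neither.
  have key : ∀ w ∈ M, ∃ r ∈ O, H.Adj w r ∧ (∀ z, H.Adj w z → H.Adj z u → ¬ H.Adj z r) ∧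
      ∀ z, OHeavyPair H w z → H.Adj z u → ¬ H.Adj z r := by
    intro w hw
    obtain ⟨hwu, hwv⟩ : H.Adj u w ∧ H.Adj v w := by simpa [hM] using hw
    obtain ⟨C₁, C₂, hun, hdisj, -, hcross, hu₁, ⟨r, hr⟩, hz⟩ :=
      hc.exists_split (hx w) hwu.symm hwv.symm huv.1 huv.2.1
    have hwr : H.Adj w r := by
      have : r ∈ C₁ ∪ C₂ := Or.inr hr
      rwa [hun] at this
    have huv' : (bcGraph H w).Adj u v := Or.inr ⟨hwu.symm, hwv.symm, huv⟩
    have hv₁ : v ∈ C₁ := by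
      have : v ∈ C₁ ∪ C₂ := by
        rw [hun]
        exact hwv.symm
      exact this.resolve_right fun h => hcross u hu₁ v h huv'
    refine ⟨r, ?_, hwr, ?_, fun z hz' h₁ h₂ => hz z hz' u hu₁ r hr h₁ h₂⟩
    · simp only [hO, Finset.mem_filter, Finset.mem_univ, true_and]
      exact ⟨fun h => Set.disjoint_left.1 hdisj hu₁ (h ▸ hr),
        fun h => Set.disjoint_left.1 hdisj hv₁ (h ▸ hr), fun h => hcross u hu₁ r hr (Or.inl h),
        fun h => hcross v hv₁ r hr (Or.inl h)⟩
    · intro z hwz hzu hzr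
      have : z ∈ C₁ ∪ C₂ := by
        rw [hun]
        exact hwz
      rcases this with h | h
      · exact hcross z h r hr (Or.inl hzr)
      · exact hcross u hu₁ z h (Or.inl hzu.symm)
  choose! f hfO hf₁ hf₂ hf₃ using key
  -- By counting, two common neighbours share the same `r`. If adjacent, `w'` would join the two
  -- parts at `w`. If not, they are not an `o`-heavy pair, so they lie in different parts at `u`,
  -- and `v` makes `u` eligible by (ii).
  obtain ⟨w, hw, w', hw', hne, hff⟩ := Finset.exists_ne_map_eq_of_card_lt_of_maps_to
    (by omega : O.card < M.card) hfO
  obtain ⟨hwu, hwv⟩ : H.Adj u w ∧ H.Adj v w := by simpa [hM] using hw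
  obtain ⟨hwu', hwv'⟩ : H.Adj u w' ∧ H.Adj v w' := by simpa [hM] using hw'
  have hr' : H.Adj w' (f w) := hff ▸ hf₁ w' hw'
  by_cases hadj : H.Adj w w'
  · exact hf₂ w hw w' hadj hwu'.symm hr'
  · have ho : ¬ OHeavyPair H w w' := fun h => hf₃ w hw w' h hwu'.symm hr'
    obtain ⟨C₁, C₂, hun, -, hcl, -, hw₁, -, hz⟩ :=
      hc.exists_split (hx u) hwu hwu' hne hadj
    have hw₂ : w' ∈ C₂ := by
      have : w' ∈ C₁ ∪ C₂ := by
        rw [hun]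
        exact hwu'
      refine this.resolve_left fun h => ?_
      rcases hcl hw₁ h hne with h' | ⟨-, -, h'⟩
      · exact hadj h'
      · exact ho h'
    exact hz v huv w hw₁ w' hw₂ hwv hwv'

/-- The local structure of a closed graph: no `o`-heavy pairs, and each neighbourhood is a
disjoint union of at most two cliques. -/
structure IsClosed (H : SimpleGraph V) : Prop where
  lt_of_not_adj : ∀ u v, u ≠ v → ¬ H.Adj u v → deg H u + deg H v < Fintype.card V
  no_claw : ∀ x u v w, H.Adj x u → H.Adj x v → H.Adj x w → u ≠ v → u ≠ w → v ≠ w →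
    H.Adj u v ∨ H.Adj u w ∨ H.Adj v w
  trans : ∀ x u v w, H.Adj x u → H.Adj x v → H.Adj x w → H.Adj u v → H.Adj v w → u ≠ w →
    H.Adj u w

theorem NoClaw.isClosed (hc : NoClaw H) (hx : ∀ x, ¬ CEligible H x) : IsClosed H := by
  have h₁ : ∀ u v, u ≠ v → ¬ H.Adj u v → deg H u + deg H v < Fintype.card V :=
    fun u v hne hadj => lt_of_not_ge fun h => hc.not_oHeavyPair hx u v ⟨hne, hadj, h⟩
  have h₂ : ∀ x u v w, H.Adj x u → H.Adj x v → H.Adj x w → u ≠ v → u ≠ w → v ≠ w →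
      H.Adj u v ∨ H.Adj u w ∨ H.Adj v w := by
    intro x u v w hu hv hw huv huw hvw
    by_contra! h
    exact hc x u v w hu hv hw ⟨huv, h.1, h₁ _ _ huv h.1⟩ ⟨huw, h.2.1, h₁ _ _ huw h.2.1⟩
      ⟨hvw, h.2.2, h₁ _ _ hvw h.2.2⟩
  refine ⟨h₁, h₂, fun x u v w hu hv hw huv hvw huw => ?_⟩
  by_contra hadj
  obtain ⟨C₁, C₂, hun, hdisj, hcl, hcross, hu₁, ⟨r, hr⟩, -⟩ :=
    hc.exists_split (hx x) hu hw huw hadj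
  have hxr : H.Adj x r := by
    have : r ∈ C₁ ∪ C₂ := Or.inr hr
    rwa [hun] at this
  have hv₁ : v ∈ C₁ := by
    have : v ∈ C₁ ∪ C₂ := by
      rw [hun]
      exact hv
    exact this.resolve_right fun h => hcross u hu₁ v h (Or.inl huv)
  have hw₁ : w ∈ C₁ := by
    have : w ∈ C₁ ∪ C₂ := by
      rw [hun]
      exact hw
    exact this.resolve_right fun h => hcross v hv₁ w h (Or.inl hvw)
  rcases hcl hu₁ hw₁ huw with h | ⟨-, -, h⟩
  · exact hadj h
  · exact hc.not_oHeavyPair hx u w h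

theorem IsClosed.clawFree (h : IsClosed H) : ClawFree H := by
  rintro ⟨φ⟩
  have hadj : ∀ i, H.Adj (φ (Sum.inl 0)) (φ (Sum.inr i)) := fun i =>
    φ.map_rel_iff.2 (by simp [claw])
  have hne : ∀ i j, i ≠ j → φ (Sum.inr i) ≠ φ (Sum.inr j) := fun i j hij h' =>
    hij (by simpa using φ.injective h')
  have hnadj : ∀ i j : Fin 3, ¬ H.Adj (φ (Sum.inr i)) (φ (Sum.inr j)) := fun i j h' => by
    have := φ.map_rel_iff.1 h'
    simp [claw] at this
  rcases h.no_claw _ _ _ _ (hadj 0) (hadj 1) (hadj 2) (hne 0 1 (by decide)) (hne 0 2 (by decide))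
    (hne 1 2 (by decide)) with h' | h' | h'
  · exact hnadj _ _ h'
  · exact hnadj _ _ h'
  · exact hnadj _ _ h'

end Closed

/-! ### Branches at the vertices of a light triangle -/

section Branches

variable {V : Type*} [Fintype V] {H : SimpleGraph V}

theorem IsClosed.far (h : IsClosed H) {u v : V} (hne : u ≠ v) (hadj : ¬ H.Adj u v) : Far H u v :=
  ⟨hne, hadj, h.lt_of_not_adj u v hne hadj⟩

/-- A triangle none of whose edges is an `a`-heavy pair. -/
structure LightTriangle (H : SimpleGraph V) (a₁ a₂ a₃ : V) : Prop where
  adj₁₂ : H.Adj a₁ a₂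
  adj₁₃ : H.Adj a₁ a₃
  adj₂₃ : H.Adj a₂ a₃
  lt₁₂ : deg H a₁ + deg H a₂ < Fintype.card V
  lt₁₃ : deg H a₁ + deg H a₃ < Fintype.card V
  lt₂₃ : deg H a₂ + deg H a₃ < Fintype.card V

/-- `b` is a neighbour of `a` outside the clique that contains the edge `a a'`. -/
def Branch (H : SimpleGraph V) (a a' b : V) : Prop :=
  H.Adj a b ∧ b ≠ a' ∧ ¬ H.Adj a' b

/-- `a` forms an `a`-heavy pair of degree sum at least `|V(H)| + 2` with one of its branches. -/
def HeavyBranch (H : SimpleGraph V) (a a' : V) : Prop :=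
  ∃ b, Branch H a a' b ∧ Fintype.card V + 2 ≤ deg H a + deg H b

variable {a₁ a₂ a₃ b b' p d y v : V}

theorem LightTriangle.rotate (T : LightTriangle H a₁ a₂ a₃) : LightTriangle H a₂ a₃ a₁ :=
  ⟨T.adj₂₃, T.adj₁₂.symm, T.adj₁₃.symm, T.lt₂₃, by have := T.lt₁₂; omega, by have := T.lt₁₃; omega⟩

theorem LightTriangle.swap (T : LightTriangle H a₁ a₂ a₃) : LightTriangle H a₁ a₃ a₂ :=
  ⟨T.adj₁₃, T.adj₁₂, T.adj₂₃.symm, T.lt₁₃, T.lt₁₂, by have := T.lt₂₃; omega⟩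

theorem LightTriangle.swap' (T : LightTriangle H a₁ a₂ a₃) : LightTriangle H a₂ a₁ a₃ :=
  T.rotate.swap

/-- Transitivity of adjacency inside the neighbourhood of `a₁`: the reference vertex may be either
of the other two triangle vertices. -/
theorem Branch.congr (hcl : IsClosed H) (T : LightTriangle H a₁ a₂ a₃) (h : Branch H a₁ a₂ b) :
    Branch H a₁ a₃ b := by
  refine ⟨h.1, fun h' => h.2.2 (h' ▸ T.adj₂₃), fun h' => h.2.2 ?_⟩
  exact hcl.trans a₁ a₂ a₃ b T.adj₁₂ T.adj₁₃ h.1 T.adj₂₃ h' h.2.1.symm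

theorem HeavyBranch.congr (hcl : IsClosed H) (T : LightTriangle H a₁ a₂ a₃)
    (h : HeavyBranch H a₁ a₂) : HeavyBranch H a₁ a₃ := by
  obtain ⟨b, hb, hd⟩ := h
  exact ⟨b, hb.congr hcl T, hd⟩

theorem Branch.adj (hcl : IsClosed H) (h12 : H.Adj a₁ a₂) (h : Branch H a₁ a₂ b)
    (h' : Branch H a₁ a₂ b') (hne : b ≠ b') : H.Adj b b' := by
  rcases hcl.no_claw a₁ a₂ b b' h12 h.1 h'.1 h.2.1.symm h'.2.1.symm hne with k | k | k
  · exact absurd k h.2.2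
  · exact absurd k h'.2.2
  · exact k

theorem Branch.of_adj (hcl : IsClosed H) (h12 : H.Adj a₁ a₂) (h : Branch H a₁ a₂ b)
    (hy : H.Adj b y) (hay : H.Adj a₁ y) : Branch H a₁ a₂ y := by
  refine ⟨hay, fun h' => h.2.2 (h' ▸ hy.symm), fun h' => h.2.2 ?_⟩
  exact hcl.trans a₁ a₂ y b h12 hay h.1 h' hy.symm h.2.1.symm

theorem Branch.of_adj_adj (hcl : IsClosed H) (h12 : H.Adj a₁ a₂) (h : Branch H a₁ a₂ b)
    (h' : Branch H a₁ a₂ b') (hne : b ≠ b') (hy : H.Adj b y) (hy' : H.Adj b' y) :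
    y = a₁ ∨ Branch H a₁ a₂ y := by
  by_cases hya : y = a₁
  · exact Or.inl hya
  · exact Or.inr (h.of_adj hcl h12 hy (hcl.trans b a₁ b' y h.1.symm (h.adj hcl h12 h' hne) hy h'.1
      hy' fun h => hya h.symm))

/-- In a maximal clique `S` with a pair of degree sum at least `|V| + 2`, some vertex outside the
pair has no neighbours outside `S`. -/
theorem exists_interior (S : Finset V) {p q : V} (hp : p ∈ S) (hq : q ∈ S) (hpq : p ≠ q)
    (hd : Fintype.card V + 2 ≤ deg H p + deg H q)
    (hS : ∀ v ∈ S, ∀ w ∈ S, v ≠ w → ∀ y, y ∉ S → H.Adj v y → ¬ H.Adj w y) :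
    ∃ v ∈ S, v ≠ p ∧ v ≠ q ∧ ∀ y, H.Adj v y → y ∈ S := by
  classical
  by_contra! hcon
  -- The outside neighbours chosen for the vertices other than `p`, `q` are distinct, and disjoint
  -- from `S` and from the outside neighbours of `p` and `q`; counting all these vertices bounds the
  -- degree sum of `p` and `q` by `n`.
  choose! f hf hfS using hcon
  set E : V → Finset V := fun v => Finset.univ.filter fun y => H.Adj v y ∧ y ∉ S with hE
  have hdeg : ∀ v ∈ S, deg H v + 1 ≤ S.card + (E v).card := by
    intro v hv
    have h1 := deg_le_card H v (S.erase v ∪ E v) (by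
      intro w hw
      by_cases hwS : w ∈ S
      · exact Finset.mem_union_left _ (Finset.mem_erase.2 ⟨hw.ne', hwS⟩)
      · exact Finset.mem_union_right _ (by simp [hE, hw, hwS]))
    have h2 := Finset.card_union_le (S.erase v) (E v)
    have h3 := Finset.card_erase_add_one hv
    omega
  set R := (S.erase p).erase q with hR
  have hRm : ∀ v, v ∈ R ↔ v ≠ q ∧ v ≠ p ∧ v ∈ S := by simp [hR]
  have hRc : R.card + 2 = S.card := by
    have h1 := Finset.card_erase_add_one hp
    have h2 := Finset.card_erase_add_one (Finset.mem_erase.2 ⟨hpq.symm, hq⟩)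
    rw [← hR] at h2
    omega
  have hinj : Set.InjOn f R := by
    intro v hv w hw hvw
    by_contra hne
    have hv' := (hRm v).1 hv
    have hw' := (hRm w).1 hw
    refine hS v hv'.2.2 w hw'.2.2 hne (f v) (hfS v hv'.2.2 hv'.2.1 hv'.1)
      (hf v hv'.2.2 hv'.2.1 hv'.1) ?_
    rw [hvw]
    exact hf w hw'.2.2 hw'.2.1 hw'.1
  have hI : (R.image f).card = R.card := Finset.card_image_of_injOn hinj
  have hEm : ∀ v y, y ∈ E v ↔ H.Adj v y ∧ y ∉ S := by simp [hE]
  have hIm : ∀ y, y ∈ R.image f → y ∉ S ∧ ∃ v ∈ R, H.Adj v y := by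
    intro y hy
    obtain ⟨v, hv, rfl⟩ := Finset.mem_image.1 hy
    have hv' := (hRm v).1 hv
    exact ⟨hfS v hv'.2.2 hv'.2.1 hv'.1, v, hv, hf v hv'.2.2 hv'.2.1 hv'.1⟩
  have d1 : Disjoint S (E p) := Finset.disjoint_left.2 fun y hy hy' => ((hEm _ _).1 hy').2 hy
  have d2 : Disjoint (S ∪ E p) (E q) := by
    rw [Finset.disjoint_left]
    intro y hy hy'
    have h2 := (hEm _ _).1 hy'
    rcases Finset.mem_union.1 hy with h | h
    · exact h2.2 h
    · exact hS p hp q hq hpq y h2.2 ((hEm _ _).1 h).1 h2.1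
  have d3 : Disjoint ((S ∪ E p) ∪ E q) (R.image f) := by
    rw [Finset.disjoint_left]
    intro y hy hy'
    obtain ⟨hyS, v, hv, hvy⟩ := hIm y hy'
    have hv' := (hRm v).1 hv
    rcases Finset.mem_union.1 hy with h | h
    · rcases Finset.mem_union.1 h with h | h
      · exact hyS h
      · exact hS p hp v hv'.2.2 (Ne.symm hv'.2.1) y hyS ((hEm _ _).1 h).1 hvy
    · exact hS q hq v hv'.2.2 (Ne.symm hv'.1) y hyS ((hEm _ _).1 h).1 hvy
  have hc := Finset.card_le_univ (((S ∪ E p) ∪ E q) ∪ R.image f)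
  rw [Finset.card_union_of_disjoint d3, Finset.card_union_of_disjoint d2,
    Finset.card_union_of_disjoint d1, hI] at hc
  have h1 := hdeg p hp
  have h2 := hdeg q hq
  omega

open scoped Classical in
/-- The clique formed by `a` and its branches. -/
noncomputable def star (H : SimpleGraph V) (a a' : V) : Finset V :=
  Finset.univ.filter fun w => w = a ∨ Branch H a a' w

theorem mem_star : v ∈ star H a₁ a₂ ↔ v = a₁ ∨ Branch H a₁ a₂ v := by
  simp [star]

theorem card_star_le (hcl : IsClosed H) (h12 : H.Adj a₁ a₂) (hv : v ∈ star H a₁ a₂) :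
    (star H a₁ a₂).card ≤ deg H v + 1 := by
  classical
  rw [← Finset.card_erase_add_one hv]
  refine Nat.add_le_add_right (card_le_deg _ _ _ fun w hw => ?_) 1
  obtain ⟨hne, hw⟩ := Finset.mem_erase.1 hw
  rcases mem_star.1 hv with rfl | hv
  · rcases mem_star.1 hw with rfl | hw
    · exact absurd rfl hne
    · exact hw.1
  · rcases mem_star.1 hw with rfl | hw
    · exact hv.1.symm
    · exact hv.adj hcl h12 hw hne.symm

theorem star_disjoint (hcl : IsClosed H) (h12 : H.Adj a₁ a₂) (v : V) (hv : v ∈ star H a₁ a₂)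
    (w : V) (hw : w ∈ star H a₁ a₂) (hne : v ≠ w) (y : V) (hy : y ∉ star H a₁ a₂)
    (hvy : H.Adj v y) : ¬ H.Adj w y := by
  intro hwy
  refine hy (mem_star.2 ?_)
  rcases mem_star.1 hv with rfl | hv
  · rcases mem_star.1 hw with rfl | hw
    · exact absurd rfl hne
    · exact Or.inr (hw.of_adj hcl h12 hwy hvy)
  · rcases mem_star.1 hw with rfl | hw
    · exact Or.inr (hv.of_adj hcl h12 hvy hwy)
    · exact hv.of_adj_adj hcl h12 hw hne hvy hwy

theorem exists_interior_branch (hcl : IsClosed H) (h12 : H.Adj a₁ a₂) {p q : V}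
    (hp : p ∈ star H a₁ a₂) (hq : q ∈ star H a₁ a₂) (hpq : p ≠ q)
    (hd : Fintype.card V + 2 ≤ deg H p + deg H q) :
    ∃ v, Branch H a₁ a₂ v ∧ v ≠ p ∧ v ≠ q ∧ (∀ y, H.Adj v y → y ∈ star H a₁ a₂) ∧
      deg H v + 1 = (star H a₁ a₂).card := by
  classical
  obtain ⟨v, hv, hvp, hvq, hint⟩ := exists_interior _ hp hq hpq hd (star_disjoint hcl h12)
  refine ⟨v, ?_, hvp, hvq, hint, le_antisymm ?_ (card_star_le hcl h12 hv)⟩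
  · refine (mem_star.1 hv).resolve_left ?_
    rintro rfl
    rcases mem_star.1 (hint a₂ h12) with h | h
    · exact h12.ne h.symm
    · exact h.2.1 rfl
  · rw [← Finset.card_erase_add_one hv]
    exact Nat.add_le_add_right (deg_le_card _ _ _ fun w hw =>
      Finset.mem_erase.2 ⟨hw.ne', hint w hw⟩) 1

/-- The pairs `a₁ b'` and `a₂ b` are nonadjacent, so each has degree sum below `n`; the two heavy
branches would give the same four degrees a total of at least `2n + 4`. -/
theorem HeavyBranch.not_both (hcl : IsClosed H) (h₁ : HeavyBranch H a₁ a₂)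
    (h₂ : HeavyBranch H a₂ a₁) : False := by
  obtain ⟨b, hb, hd⟩ := h₁
  obtain ⟨b', hb', hd'⟩ := h₂
  have h1 := hcl.lt_of_not_adj a₁ b' hb'.2.1.symm hb'.2.2
  have h2 := hcl.lt_of_not_adj a₂ b hb.2.1.symm hb.2.2
  omega

theorem Branch.not_adj_of_adj (hcl : IsClosed H) (h12 : H.Adj a₁ a₂) (hb : Branch H a₁ a₂ b)
    (hp : Branch H a₁ a₂ p) (hne : b ≠ p) (hd : Branch H a₂ a₁ d) (hpd : H.Adj p d) :
    ¬ H.Adj b d := fun h => by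
  rcases hb.of_adj_adj hcl h12 hp hne h hpd with h | h
  · exact hd.2.1 h
  · exact hd.2.2 h.1

/-- Otherwise `PatternF` occurs, with `d` serving both as the end of `p d` and as `b₂`. -/
theorem le_deg_of_cross (hcl : IsClosed H) (hP : PatternFree H) (T : LightTriangle H a₁ a₂ a₃)
    (hn : ¬ HeavyBranch H a₁ a₂) (hp : Branch H a₁ a₂ p) (hd : Branch H a₂ a₁ d)
    (hpd : H.Adj p d) (hb' : Branch H a₃ a₁ b') (hpb' : ¬ H.Adj p b') (hdb' : ¬ H.Adj d b')
    (hb : Branch H a₁ a₂ b) (hbp : b ≠ p) (hbb' : ¬ H.Adj b b') :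
    Fintype.card V + 2 ≤ deg H b + deg H p := by
  by_contra hlt
  have hb₃ := hb.congr hcl T
  have hp₃ := hp.congr hcl T
  have hd₃ := hd.congr hcl T.swap'
  have hb'₂ := hb'.congr hcl T.swap.rotate.swap
  have hbd := hb.not_adj_of_adj hcl T.adj₁₂ hp hbp hd hpd
  have l : ∀ c, Branch H a₁ a₂ c → Light H a₁ c := fun c hc =>
    ⟨hc.1, lt_of_not_ge fun h => hn ⟨c, hc, h⟩⟩
  have t₁ := T.lt₁₂
  have t₂ := T.lt₁₃
  have t₃ := T.lt₂₃
  have n₁ : b ≠ d := fun h => hd.2.2 (h ▸ hb.1)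
  have n₂ : b ≠ b' := fun h => hb'.2.2 (h ▸ hb.1)
  have n₃ : p ≠ b' := fun h => hb'.2.2 (h ▸ hp.1)
  have n₄ : d ≠ b' := fun h => hb'₂.2.2 (h ▸ hd.1)
  exact hP.noF a₁ a₂ a₃ b p d d b'
    { la₁₂ := ⟨T.adj₁₂, by omega⟩
      la₁₃ := ⟨T.adj₁₃, by omega⟩
      la₂₃ := ⟨T.adj₂₃, by omega⟩
      lb := l b hb
      lp := l p hp
      lbp := ⟨hb.adj hcl T.adj₁₂ hp hbp, lt_of_not_ge hlt⟩
      ed := hpd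
      eb₂ := hd.1
      eb₃ := hb'.1
      fa₁d := hcl.far hd.2.1.symm hd.2.2
      fa₁b₂ := hcl.far hd.2.1.symm hd.2.2
      fa₁b₃ := hcl.far hb'.2.1.symm hb'.2.2
      fa₂b := hcl.far hb.2.1.symm hb.2.2
      fa₂p := hcl.far hp.2.1.symm hp.2.2
      fa₂b₃ := hcl.far hb'₂.2.1.symm hb'₂.2.2
      fa₃b := hcl.far hb₃.2.1.symm hb₃.2.2
      fa₃p := hcl.far hp₃.2.1.symm hp₃.2.2
      fa₃d := hcl.far hd₃.2.1.symm hd₃.2.2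
      fa₃b₂ := hcl.far hd₃.2.1.symm hd₃.2.2
      fbd := hcl.far n₁ hbd
      fbb₂ := hcl.far n₁ hbd
      fbb₃ := hcl.far n₂ hbb'
      fpb₃ := hcl.far n₃ hpb'
      fdb₃ := hcl.far n₄ hdb'
      fb₂₃ := hcl.far n₄ hdb' }

/-- The bound on `b`, `p` yields a branch `v` with all its neighbours in the clique `star H a₁ a₂`.
The bound applies again to `v`, `p`, and `a₁` has degree at least that of `v`, so `p` is a heavy
branch. -/
theorem heavyBranch_of_cross (hcl : IsClosed H) (hP : PatternFree H)
    (T : LightTriangle H a₁ a₂ a₃) (hp : Branch H a₁ a₂ p) (hd : Branch H a₂ a₁ d)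
    (hpd : H.Adj p d) (hb' : Branch H a₃ a₁ b') (hpb' : ¬ H.Adj p b') (hdb' : ¬ H.Adj d b')
    (hb : Branch H a₁ a₂ b) (hbp : b ≠ p) (hbb' : ¬ H.Adj b b') : HeavyBranch H a₁ a₂ := by
  by_contra hn
  have h := le_deg_of_cross hcl hP T hn hp hd hpd hb' hpb' hdb' hb hbp hbb'
  obtain ⟨v, hv, -, hvp, hint, hcard⟩ := exists_interior_branch hcl T.adj₁₂
    (mem_star.2 (Or.inr hb)) (mem_star.2 (Or.inr hp)) hbp h
  have hvb' : ¬ H.Adj v b' := fun h => by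
    rcases mem_star.1 (hint b' h) with h | h
    · exact hb'.2.1 h
    · exact hb'.2.2 h.1
  have h' := le_deg_of_cross hcl hP T hn hp hd hpd hb' hpb' hdb' hv hvp hvb'
  have := card_star_le (v := a₁) hcl T.adj₁₂ (mem_star.2 (Or.inl rfl))
  exact hn ⟨p, hp, by omega⟩

/-- A 2-connected graph: from the branches at `a₁` an edge leads to a vertex other than `a₁`. -/
theorem exists_exit (hcl : IsClosed H) (h2 : TwoConnected H) (h12 : H.Adj a₁ a₂)
    (hb : Branch H a₁ a₂ b) :
    ∃ p c, Branch H a₁ a₂ p ∧ H.Adj p c ∧ c ≠ a₁ ∧ ¬ H.Adj a₁ c := by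
  -- A walk from `b` to `a₂` avoiding `a₁` has to leave the set of branches.
  obtain ⟨w⟩ := (h2.2.2 a₁).preconnected ⟨b, hb.1.ne'⟩ ⟨a₂, h12.ne'⟩
  obtain ⟨e, -, he₁, he₂⟩ := w.exists_boundary_dart {w | Branch H a₁ a₂ w.1} hb fun h => h.2.1 rfl
  exact ⟨e.fst.1, e.snd.1, he₁, e.adj, e.snd.2, fun h => he₂ (he₁.of_adj hcl h12 e.adj h)⟩

end Branches

/-! ### Nets of a closed graph that are not `p`-heavy -/

section Nets

variable {V : Type*} [Fintype V] {H : SimpleGraph V}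

/-- An induced net whose triangle contains no `a`-heavy pair. -/
structure LightNet (H : SimpleGraph V) (a₁ a₂ a₃ b₁ b₂ b₃ : V) : Prop where
  tri : LightTriangle H a₁ a₂ a₃
  br₁ : Branch H a₁ a₂ b₁
  br₂ : Branch H a₂ a₃ b₂
  br₃ : Branch H a₃ a₁ b₃
  nadj₁₂ : ¬ H.Adj b₁ b₂
  nadj₁₃ : ¬ H.Adj b₁ b₃
  nadj₂₃ : ¬ H.Adj b₂ b₃

variable {a₁ a₂ a₃ b₁ b₂ b₃ : V}

theorem LightNet.rotate (N : LightNet H a₁ a₂ a₃ b₁ b₂ b₃) : LightNet H a₂ a₃ a₁ b₂ b₃ b₁ :=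
  ⟨N.tri.rotate, N.br₂, N.br₃, N.br₁, N.nadj₂₃, fun h => N.nadj₁₂ h.symm,
    fun h => N.nadj₁₃ h.symm⟩

theorem LightNet.swap (hcl : IsClosed H) (N : LightNet H a₁ a₂ a₃ b₁ b₂ b₃) :
    LightNet H a₁ a₃ a₂ b₁ b₃ b₂ :=
  ⟨N.tri.swap, N.br₁.congr hcl N.tri, N.br₃.congr hcl N.tri.rotate.rotate,
    N.br₂.congr hcl N.tri.rotate, N.nadj₁₃, N.nadj₁₂, fun h => N.nadj₂₃ h.symm⟩

/-- A path of length two leaving the triangle at a vertex without heavy branches meets the other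
branches. -/
theorem heavyBranch_of_tail (hcl : IsClosed H) (hP : PatternFree H) (T : LightTriangle H a₁ a₂ a₃)
    {c : V} (hb₁ : Branch H a₁ a₂ b₁) (hb₂ : Branch H a₂ a₁ b₂) (hb₃ : Branch H a₃ a₁ b₃)
    (h₁₂ : ¬ H.Adj b₁ b₂) (h₁₃ : ¬ H.Adj b₁ b₃) (h₂₃ : ¬ H.Adj b₂ b₃) (hc : H.Adj b₁ c)
    (hca₁ : c ≠ a₁) (ha₁c : ¬ H.Adj a₁ c) (ha₂c : ¬ H.Adj a₂ c) (ha₃c : ¬ H.Adj a₃ c)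
    (hb₃c : ¬ H.Adj b₃ c) : HeavyBranch H a₁ a₂ := by
  by_contra hn
  have t₁ := T.lt₁₂
  have t₂ := T.lt₁₃
  have t₃ := T.lt₂₃
  have hb₁' := hb₁.congr hcl T
  have hb₂' := hb₂.congr hcl T.swap'
  have hb₃' := hb₃.congr hcl T.rotate.rotate
  exact hP.noQ a₁ a₂ a₃ b₁ b₂ b₃ c
    { la₁₂ := ⟨T.adj₁₂, by omega⟩
      la₁₃ := ⟨T.adj₁₃, by omega⟩
      la₂₃ := ⟨T.adj₂₃, by omega⟩
      lb₁ := ⟨hb₁.1, lt_of_not_ge fun h => hn ⟨b₁, hb₁, h⟩⟩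
      eb₂ := hb₂.1
      eb₃ := hb₃.1
      ec := hc
      fa₁b₂ := hcl.far hb₂.2.1.symm hb₂.2.2
      fa₁b₃ := hcl.far hb₃.2.1.symm hb₃.2.2
      fa₁c := hcl.far hca₁.symm ha₁c
      fa₂b₁ := hcl.far hb₁.2.1.symm hb₁.2.2
      fa₂b₃ := hcl.far hb₃'.2.1.symm hb₃'.2.2
      fa₂c := hcl.far (fun h => hb₁.2.2 (h ▸ hc.symm)) ha₂c
      fa₃b₁ := hcl.far hb₁'.2.1.symm hb₁'.2.2
      fa₃b₂ := hcl.far hb₂'.2.1.symm hb₂'.2.2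
      fa₃c := hcl.far (fun h => hb₁'.2.2 (h ▸ hc.symm)) ha₃c
      fb₁₂ := hcl.far (fun h => hb₂.2.2 (h ▸ hb₁.1)) h₁₂
      fb₁₃ := hcl.far (fun h => hb₃.2.2 (h ▸ hb₁.1)) h₁₃
      fb₂₃ := hcl.far (fun h => hb₂'.2.2 (h ▸ hb₃.1)) h₂₃
      fb₃c := hcl.far (fun h => h₁₃ (h ▸ hc)) hb₃c }

theorem LightNet.exists_cross (hcl : IsClosed H) (hP : PatternFree H) (h2 : TwoConnected H)
    (N : LightNet H a₁ a₂ a₃ b₁ b₂ b₃) (hn : ¬ HeavyBranch H a₁ a₂) :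
    ∃ p d, Branch H a₁ a₂ p ∧ H.Adj p d ∧ (Branch H a₂ a₁ d ∨ Branch H a₃ a₁ d) := by
  by_contra! hcon
  have T := N.tri
  have hb₂ : Branch H a₂ a₁ b₂ := N.br₂.congr hcl T.rotate
  obtain ⟨p, c, hp, hpc, hca, hac⟩ := exists_exit hcl h2 T.adj₁₂ N.br₁
  have hp₃ := hp.congr hcl T
  have h₁₂ : ¬ H.Adj p b₂ := fun h => (hcon p b₂ hp h).1 hb₂
  have h₁₃ : ¬ H.Adj p b₃ := fun h => (hcon p b₃ hp h).2 N.br₃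
  have h₂ : ¬ H.Adj a₂ c := fun h => (hcon p c hp hpc).1 ⟨h, hca, hac⟩
  have h₃ : ¬ H.Adj a₃ c := fun h => (hcon p c hp hpc).2 ⟨h, hca, hac⟩
  -- The vertex `c` cannot see both `b₂` and `b₃`, or it would centre a claw with `p`. The tail
  -- argument needs only one nonneighbour among them, after exchanging `a₂` and `a₃` if necessary.
  by_cases hc₃ : H.Adj b₃ c
  · by_cases hc₂ : H.Adj b₂ c
    · rcases hcl.no_claw c p b₂ b₃ hpc.symm hc₂.symm hc₃.symm
        (fun h => hp.2.2 (h ▸ hb₂.1)) (fun h => hp₃.2.2 (h ▸ N.br₃.1))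
        (fun h => N.br₂.2.2 (h ▸ N.br₃.1)) with h | h | h
      · exact h₁₂ h
      · exact h₁₃ h
      · exact N.nadj₂₃ h
    · exact hn ((heavyBranch_of_tail hcl hP T.swap hp₃ N.br₃ hb₂ h₁₃ h₁₂
        (fun h => N.nadj₂₃ h.symm) hpc hca hac h₃ h₂ hc₂).congr hcl T.swap)
  · exact hn (heavyBranch_of_tail hcl hP T hp hb₂ N.br₃ h₁₂ h₁₃ N.nadj₂₃ hpc hca hac h₂ h₃ hc₃)

/-- Branches at three different vertices of the triangle: adjacency to the ends of an edge between
two of them is the same. -/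
theorem Branch.adj_of_cross (hcl : IsClosed H) (T : LightTriangle H a₁ a₂ a₃) {p d y : V}
    (hp : Branch H a₁ a₂ p) (hd : Branch H a₂ a₁ d) (hpd : H.Adj p d) (hy : Branch H a₃ a₁ y)
    (hdy : H.Adj d y) : H.Adj p y := by
  have hy₂ := hy.congr hcl T.rotate.rotate
  rcases hcl.no_claw d a₂ p y hd.1.symm hpd.symm hdy hp.2.1.symm hy₂.2.1.symm
    (fun h => hy.2.2 (h ▸ hp.1)) with h | h | h
  · exact absurd h hp.2.2
  · exact absurd h hy₂.2.2
  · exact h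

/-- An edge between branches at `a₁` and `a₂` forces a heavy branch at one of the vertices of the
triangle. -/
theorem LightNet.heavyBranch_of_cross (hcl : IsClosed H) (hP : PatternFree H)
    (N : LightNet H a₁ a₂ a₃ b₁ b₂ b₃) {p d : V} (hp : Branch H a₁ a₂ p) (hd : Branch H a₂ a₁ d)
    (hpd : H.Adj p d) : HeavyBranch H a₁ a₂ ∨ HeavyBranch H a₂ a₁ := by
  have T := N.tri
  have hb₂ : Branch H a₂ a₁ b₂ := N.br₂.congr hcl T.rotate
  have hb₃' := N.br₃.congr hcl T.rotate.rotate
  by_cases h₃ : H.Adj p b₃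
  · have hp₃ := hp.congr hcl T
    have hb₁p : b₁ ≠ p := fun h => N.nadj₁₃ (h ▸ h₃)
    have hpb₂ : ¬ H.Adj p b₂ := by
      intro h
      rcases hcl.no_claw p a₁ b₂ b₃ hp.1.symm h h₃ hb₂.2.1.symm N.br₃.2.1.symm
        (fun h => N.br₂.2.2 (h ▸ N.br₃.1)) with h | h | h
      · exact hb₂.2.2 h
      · exact N.br₃.2.2 h
      · exact N.nadj₂₃ h
    exact Or.inl ((HeavyPairs.heavyBranch_of_cross hcl hP T.swap hp₃ N.br₃ h₃ hb₂ hpb₂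
      (fun h => N.nadj₂₃ h.symm) (N.br₁.congr hcl T) hb₁p N.nadj₁₂).congr hcl T.swap)
  · have hdb₃ : ¬ H.Adj d b₃ := fun h => h₃ (hp.adj_of_cross hcl T hd hpd N.br₃ h)
    -- Since `b₁` and `b₂` are nonadjacent, `p d` is not the edge `b₁ b₂`; so there is a spare
    -- branch at `a₁` or at `a₂`.
    by_cases hb₁ : b₁ = p
    · have hb₂d : b₂ ≠ d := by
        rintro rfl
        exact N.nadj₁₂ (hb₁ ▸ hpd)
      exact Or.inr (HeavyPairs.heavyBranch_of_cross hcl hP T.swap' hd hp hpd.symm hb₃' hdb₃ h₃ hb₂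
        hb₂d N.nadj₂₃)
    · exact Or.inl (HeavyPairs.heavyBranch_of_cross hcl hP T hp hd hpd N.br₃ h₃ hdb₃ N.br₁ hb₁
        N.nadj₁₃)

theorem LightNet.exists_heavyBranch (hcl : IsClosed H) (hP : PatternFree H) (h2 : TwoConnected H)
    (N : LightNet H a₁ a₂ a₃ b₁ b₂ b₃) :
    HeavyBranch H a₁ a₂ ∨ HeavyBranch H a₂ a₃ ∨ HeavyBranch H a₃ a₁ := by
  have T := N.tri
  by_cases hn : HeavyBranch H a₁ a₂
  · exact Or.inl hn
  obtain ⟨p, d, hp, hpd, hd | hd⟩ := N.exists_cross hcl hP h2 hn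
  · rcases N.heavyBranch_of_cross hcl hP hp hd hpd with h | h
    · exact Or.inl h
    · exact Or.inr (Or.inl (h.congr hcl T.swap'))
  · rcases (N.swap hcl).heavyBranch_of_cross hcl hP (hp.congr hcl T) hd hpd with h | h
    · exact Or.inl (h.congr hcl T.swap)
    · exact Or.inr (Or.inr h)

/-- With a heavy branch at `a₁`, there is no edge between branches at `a₂` and at `a₃`. -/
theorem LightNet.not_adj_of_heavyBranch (hcl : IsClosed H) (hP : PatternFree H)
    (N : LightNet H a₁ a₂ a₃ b₁ b₂ b₃) (h₁ : HeavyBranch H a₁ a₂) {p d : V}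
    (hp : Branch H a₂ a₃ p) (hd : Branch H a₃ a₂ d) : ¬ H.Adj p d := by
  intro hpd
  have T := N.tri
  obtain ⟨b, hb, hbd⟩ := id h₁
  -- The branch `v` has no neighbours outside the clique at `a₁`, so it serves as the third branch
  -- for every edge `p d`. Any choice other than `b₂ b₃` would produce a second heavy branch.
  obtain ⟨v, hv, -, -, hint, -⟩ := exists_interior_branch hcl T.adj₁₂ (mem_star.2 (Or.inl rfl))
    (mem_star.2 (Or.inr hb)) hb.1.ne hbd
  have hn₂ : ¬ HeavyBranch H a₂ a₃ := fun h => h₁.not_both hcl (h.congr hcl T.rotate)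
  have hn₃ : ¬ HeavyBranch H a₃ a₂ := fun h => (h₁.congr hcl T).not_both hcl
    (h.congr hcl T.rotate.swap')
  have hint₂ : ∀ y, Branch H a₂ a₃ y → ¬ H.Adj y v := fun y hy h => by
    have hy' := hy.congr hcl T.rotate
    rcases mem_star.1 (hint y h.symm) with h | h
    · exact hy'.2.1 h
    · exact hy'.2.2 h.1
  have hint₃ : ∀ y, Branch H a₃ a₂ y → ¬ H.Adj y v := fun y hy h => by
    have hy' := hy.congr hcl T.rotate.swap'
    rcases mem_star.1 (hint y h.symm) with h | h
    · exact hy'.2.1 h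
    · exact hy'.2.2 h.1
  have hb₃' := N.br₃.congr hcl T.rotate.rotate
  have e₂ : b₂ = p := by
    by_contra hne
    exact hn₂ (HeavyPairs.heavyBranch_of_cross hcl hP T.rotate hp hd hpd hv (hint₂ _ hp)
      (hint₃ _ hd) N.br₂ hne (hint₂ _ N.br₂))
  have e₃ : b₃ = d := by
    by_contra hne
    exact hn₃ (HeavyPairs.heavyBranch_of_cross hcl hP T.rotate.swap' hd hp hpd.symm
      (hv.congr hcl T) (hint₃ _ hd) (hint₂ _ hp) hb₃' hne (hint₃ _ hb₃'))
  exact N.nadj₂₃ (e₂ ▸ e₃ ▸ hpd)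

/-- With a heavy branch at `a₁`, the vertex `b₂` is the only branch at `a₂`, and its second
neighbour is a branch at `a₁`. -/
theorem LightNet.neighbors_of_heavyBranch (hcl : IsClosed H) (hP : PatternFree H)
    (h2 : TwoConnected H) (N : LightNet H a₁ a₂ a₃ b₁ b₂ b₃) (h₁ : HeavyBranch H a₁ a₂) :
    (∀ y, Branch H a₂ a₃ y → y = b₂) ∧
      ∃ c, Branch H a₁ a₂ c ∧ ∀ y, H.Adj b₂ y ↔ y = a₂ ∨ y = c := by
  have T := N.tri
  have hn₂ : ¬ HeavyBranch H a₂ a₃ := fun h => h₁.not_both hcl (h.congr hcl T.rotate)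
  have hb₂ : Branch H a₂ a₁ b₂ := N.br₂.congr hcl T.rotate
  have hb₃' := N.br₃.congr hcl T.rotate.rotate
  have hno : ∀ p d, Branch H a₂ a₃ p → Branch H a₃ a₂ d → ¬ H.Adj p d :=
    fun p d hp hd => N.not_adj_of_heavyBranch hcl hP h₁ hp hd
  obtain ⟨p, c, hp, hpc, hc⟩ := N.rotate.exists_cross hcl hP h2 hn₂
  have hc₁ : Branch H a₁ a₂ c := hc.resolve_left fun h => hno p c hp h hpc
  have hc₃ := hc₁.congr hcl T
  have hp₁ := hp.congr hcl T.rotate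
  have hcb₃ : ¬ H.Adj c b₃ := fun h =>
    hno p b₃ hp hb₃' (hp₁.adj_of_cross hcl T.swap' hc₁ hpc hb₃' h)
  have huniq : ∀ y, Branch H a₂ a₃ y → y = p := by
    intro y hy
    by_contra hne
    exact hn₂ ((HeavyPairs.heavyBranch_of_cross hcl hP T.swap' hp₁ hc₁ hpc hb₃'
      (hno _ _ hp hb₃') hcb₃ (hy.congr hcl T.rotate) hne (hno _ _ hy hb₃')).congr hcl T.swap')
  obtain rfl := huniq b₂ N.br₂
  refine ⟨huniq, c, hc₁, fun y => ⟨fun hy => ?_, ?_⟩⟩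
  · by_contra! hne
    have hya₂ : ¬ H.Adj a₂ y := by
      intro h
      have hy₁ : Branch H a₂ a₁ y := hb₂.of_adj hcl T.adj₁₂.symm hy h
      exact hy.ne (huniq y (hy₁.congr hcl T.swap')).symm
    have hya₁ : ¬ H.Adj a₁ y := by
      intro h
      have hy₁ : Branch H a₁ a₂ y := ⟨h, hne.1, hya₂⟩
      rcases hy₁.of_adj_adj hcl T.adj₁₂ hc₁ hne.2 hy.symm hpc.symm with h | h
      · exact hb₂.2.1 h
      · exact hb₂.2.2 h.1
    have hya₃ : ¬ H.Adj a₃ y := fun h => hno _ y N.br₂ ⟨h, hne.1, hya₂⟩ hy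
    have hyb₁ : ¬ H.Adj b₁ y := by
      intro h
      have hcy : H.Adj c y := by
        rcases hcl.no_claw b₂ a₂ c y hb₂.1.symm hpc hy hc₁.2.1.symm hne.1.symm hne.2.symm with
          h | h | h
        · exact absurd h hc₁.2.2
        · exact absurd h hya₂
        · exact h
      rcases N.br₁.of_adj_adj hcl T.adj₁₂ hc₁ (fun h => N.nadj₁₂ (h ▸ hpc.symm)) h hcy with h | h
      · exact hb₂.2.2 (h ▸ hy.symm)
      · exact hya₁ h.1
    -- A third neighbour `y` of `b₂` would extend the branch `b₂` to a path of length two avoiding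
    -- `a₁`, `a₃` and `b₁`, forcing a heavy branch at `a₂`.
    exact hn₂ (heavyBranch_of_tail hcl hP T.rotate N.br₂ hb₃' N.br₁ N.nadj₂₃
      (fun h => N.nadj₁₂ h.symm) (fun h => N.nadj₁₃ h.symm) hy hne.1 hya₂ hya₃ hya₁ hyb₁)
  · rintro (rfl | rfl)
    · exact hb₂.1.symm
    · exact hpc

/-- Since `b₂` is the only branch at `a₂`, a further neighbour `y` would complete the triangle to a
complete graph on four vertices and create `PatternY`. -/
theorem LightNet.eq_of_adj (hcl : IsClosed H) (hP : PatternFree H) (h2 : TwoConnected H)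
    (N : LightNet H a₁ a₂ a₃ b₁ b₂ b₃) (h₁ : HeavyBranch H a₁ a₂) {y : V} (hy : H.Adj a₂ y) :
    y = a₁ ∨ y = a₃ ∨ y = b₂ := by
  by_contra! hne
  have T := N.tri
  have hn₃ : ¬ HeavyBranch H a₃ a₂ := fun h => (h₁.congr hcl T).not_both hcl
    (h.congr hcl T.rotate.swap')
  have hb₁' := N.br₁.congr hcl T
  have hb₂ : Branch H a₂ a₁ b₂ := N.br₂.congr hcl T.rotate
  have hb₃' := N.br₃.congr hcl T.rotate.rotate
  obtain ⟨hu₂, -⟩ := N.neighbors_of_heavyBranch hcl hP h2 h₁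
  obtain ⟨-, c, hc, hbc⟩ := (N.swap hcl).neighbors_of_heavyBranch hcl hP h2 (h₁.congr hcl T)
  have hc₂ := hc.congr hcl T.swap
  have hb₃c : H.Adj b₃ c := (hbc c).2 (Or.inr rfl)
  have hy₃ : H.Adj a₃ y := by
    by_contra h
    exact hne.2.2 (hu₂ y ⟨hy, hne.2.1, h⟩)
  have hy₁ : H.Adj a₁ y := by
    by_contra h
    exact hne.2.2 (hu₂ y (Branch.congr hcl T.swap' ⟨hy, hne.1, h⟩))
  have hyb : ∀ w, Branch H a₁ a₂ w → ¬ H.Adj y w := fun w hw h =>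
    (hw.of_adj hcl T.adj₁₂ h.symm hy₁).2.2 hy
  have hyb' : ∀ w, Branch H a₁ a₂ w → y ≠ w := fun w hw h => hw.2.2 (h ▸ hy)
  have hyb₂ : ¬ H.Adj y b₂ := fun h => (N.br₂.of_adj hcl T.adj₂₃ h.symm hy).2.2 hy₃
  have hyb₃ : ¬ H.Adj y b₃ := fun h => (hb₃'.of_adj hcl T.adj₂₃.symm h.symm hy₃).2.2 hy
  obtain ⟨b, hb, hbd⟩ := h₁
  -- Comparison with the heavy branch `b` gives `y` smaller degree than `a₁`, so the edges from `y`
  -- to `a₂` and `a₃` are light.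
  have hlt := hcl.lt_of_not_adj y b (hyb' b hb) (hyb b hb)
  have hb₂c : ¬ H.Adj b₂ c := by
    intro h
    rcases hcl.no_claw c a₁ b₂ b₃ hc.1.symm h.symm hb₃c.symm hb₂.2.1.symm N.br₃.2.1.symm
      (fun h => N.br₂.2.2 (h ▸ N.br₃.1)) with h | h | h
    · exact hb₂.2.2 h
    · exact N.br₃.2.2 h
    · exact N.nadj₂₃ h
  have t₁ := T.lt₁₂
  have t₂ := T.lt₁₃
  have t₃ := T.lt₂₃
  exact hP.noY a₁ a₂ a₃ y b₁ b₂ b₃ c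
    { la₁₂ := ⟨T.adj₁₂, by omega⟩
      la₁₃ := ⟨T.adj₁₃, by omega⟩
      la₂₃ := ⟨T.adj₂₃, by omega⟩
      la₂₄ := ⟨hy, by omega⟩
      la₃₄ := ⟨hy₃, by omega⟩
      ea₁₄ := hy₁
      eb₁ := N.br₁.1
      eb₂ := N.br₂.1
      lb₃ := ⟨N.br₃.1, lt_of_not_ge fun h => hn₃ ⟨b₃, hb₃', h⟩⟩
      ec := hb₃c
      fa₁b₂ := hcl.far hb₂.2.1.symm hb₂.2.2
      fa₁b₃ := hcl.far N.br₃.2.1.symm N.br₃.2.2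
      fa₂b₁ := hcl.far N.br₁.2.1.symm N.br₁.2.2
      fa₂b₃ := hcl.far hb₃'.2.1.symm hb₃'.2.2
      fa₂c := hcl.far hc₂.2.1.symm hc₂.2.2
      fa₃b₁ := hcl.far hb₁'.2.1.symm hb₁'.2.2
      fa₃b₂ := hcl.far N.br₂.2.1.symm N.br₂.2.2
      fa₃c := hcl.far hc.2.1.symm hc.2.2
      fa₄b₁ := hcl.far (hyb' _ N.br₁) (hyb _ N.br₁)
      fa₄b₂ := hcl.far hne.2.2 hyb₂
      fa₄b₃ := hcl.far (fun h => N.br₃.2.2 (h ▸ hy₁)) hyb₃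
      fa₄c := hcl.far (hyb' _ hc₂) (hyb _ hc₂)
      fb₁₂ := hcl.far (fun h => hb₂.2.2 (h ▸ N.br₁.1)) N.nadj₁₂
      fb₁₃ := hcl.far (fun h => N.br₃.2.2 (h ▸ N.br₁.1)) N.nadj₁₃
      fb₂₃ := hcl.far (fun h => N.br₂.2.2 (h ▸ N.br₃.1)) N.nadj₂₃
      fb₂c := hcl.far (fun h => hb₂.2.2 (h ▸ hc.1)) hb₂c }

/-- Outside the clique `star H a₁ a₂`, the vertex `c` has the single neighbour `b`: any other would
give a claw at `c` with `a₁` and `b`. -/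
theorem deg_le_card_star (hcl : IsClosed H) (h12 : H.Adj a₁ a₂) {b c : V}
    (hb : Branch H a₂ a₁ b) (hc : Branch H a₁ a₂ c) (hbc : ∀ y, H.Adj b y ↔ y = a₂ ∨ y = c) :
    deg H c ≤ (star H a₁ a₂).card := by
  classical
  have hcS : c ∈ star H a₁ a₂ := mem_star.2 (Or.inr hc)
  have hcb : H.Adj c b := ((hbc c).2 (Or.inr rfl)).symm
  have h := deg_le_card H c (insert b ((star H a₁ a₂).erase c)) (by
    intro y hy
    by_cases hyb : y = b
    · simp [hyb]
    refine Finset.mem_insert_of_mem (Finset.mem_erase.2 ⟨hy.ne', mem_star.2 ?_⟩)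
    by_cases hya : y = a₁
    · exact Or.inl hya
    right
    rcases hcl.no_claw c a₁ y b hc.1.symm hy hcb (Ne.symm hya) hb.2.1.symm hyb with h | h | h
    · exact hc.of_adj hcl h12 hy h
    · exact absurd h hb.2.2
    · rcases (hbc y).1 h.symm with rfl | rfl
      · exact absurd hy.symm hc.2.2
      · exact absurd rfl hy.ne)
  have h1 := Finset.card_insert_le b ((star H a₁ a₂).erase c)
  have h2 := Finset.card_erase_add_one hcS
  omega

theorem LightNet.qHeavy (hcl : IsClosed H) (hP : PatternFree H) (h2 : TwoConnected H)
    (N : LightNet H a₁ a₂ a₃ b₁ b₂ b₃) (h₁ : HeavyBranch H a₁ a₂) :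
    (Heavy H a₁ ∧ Heavy H b₁) ∧
      (deg H a₂ = 3 ∧ deg H b₂ = 2 ∧ ∀ c, H.Adj b₂ c → c ≠ a₂ → Heavy H c) ∧
      (deg H a₃ = 3 ∧ deg H b₃ = 2 ∧ ∀ c, H.Adj b₃ c → c ≠ a₃ → Heavy H c) := by
  classical
  have T := N.tri
  have hb₂ : Branch H a₂ a₁ b₂ := N.br₂.congr hcl T.rotate
  have hb₃' := N.br₃.congr hcl T.rotate.rotate
  obtain ⟨-, c, hc, hbc⟩ := N.neighbors_of_heavyBranch hcl hP h2 h₁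
  obtain ⟨-, d, hd₃, hbd⟩ := (N.swap hcl).neighbors_of_heavyBranch hcl hP h2 (h₁.congr hcl T)
  have hd := hd₃.congr hcl T.swap
  have hc₃ := hc.congr hcl T
  have ha₂ : ∀ y, H.Adj a₂ y → y = a₁ ∨ y = a₃ ∨ y = b₂ := fun y hy =>
    N.eq_of_adj hcl hP h2 h₁ hy
  have ha₃ : ∀ y, H.Adj a₃ y → y = a₁ ∨ y = a₂ ∨ y = b₃ := fun y hy =>
    (N.swap hcl).eq_of_adj hcl hP h2 (h₁.congr hcl T) hy
  have da₂ : deg H a₂ = 3 := by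
    rw [deg_eq_card H a₂ {a₁, a₃, b₂} (fun y => by
      simp only [Finset.mem_insert, Finset.mem_singleton]
      exact ⟨by rintro (rfl | rfl | rfl); exacts [T.adj₁₂.symm, T.adj₂₃, hb₂.1], ha₂ y⟩)]
    exact Finset.card_eq_three.2 ⟨_, _, _, T.adj₁₃.ne, hb₂.2.1.symm, N.br₂.2.1.symm, rfl⟩
  have da₃ : deg H a₃ = 3 := by
    rw [deg_eq_card H a₃ {a₁, a₂, b₃} (fun y => by
      simp only [Finset.mem_insert, Finset.mem_singleton]
      exact ⟨by rintro (rfl | rfl | rfl); exacts [T.adj₁₃.symm, T.adj₂₃.symm, N.br₃.1], ha₃ y⟩)]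
    exact Finset.card_eq_three.2 ⟨_, _, _, T.adj₁₂.ne, N.br₃.2.1.symm, hb₃'.2.1.symm, rfl⟩
  have db₂ : deg H b₂ = 2 := by
    rw [deg_eq_card H b₂ {a₂, c} (fun y => by simp [hbc])]
    exact Finset.card_pair hc.2.1.symm
  have db₃ : deg H b₃ = 2 := by
    rw [deg_eq_card H b₃ {a₃, d} (fun y => by simp [hbd])]
    exact Finset.card_pair hd₃.2.1.symm
  have hb₂c : H.Adj b₂ c := (hbc c).2 (Or.inr rfl)
  have hb₃d : H.Adj b₃ d := (hbd d).2 (Or.inr rfl)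
  set S := star H a₁ a₂ with hS
  have hb₂S : b₂ ∉ S := fun h => by
    rcases mem_star.1 h with h | h
    · exact hb₂.2.1 h
    · exact hb₂.2.2 h.1
  have hb₃S : b₃ ∉ S := fun h => by
    rcases mem_star.1 h with h | h
    · exact N.br₃.2.1 h
    · exact N.br₃.2.2 h.1
  have hcd : c ≠ d := by
    rintro rfl
    rcases hcl.no_claw c a₁ b₂ b₃ hc.1.symm hb₂c.symm hb₃d.symm hb₂.2.1.symm N.br₃.2.1.symm
      (fun h => N.br₂.2.2 (h ▸ N.br₃.1)) with h | h | h
    · exact hb₂.2.2 h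
    · exact N.br₃.2.2 h
    · exact N.nadj₂₃ h
  have hcb₃ : ¬ H.Adj c b₃ := fun h => by
    rcases (hbd c).1 h.symm with h | h
    · exact hc₃.2.1 h
    · exact hcd h
  have hdb₂ : ¬ H.Adj d b₂ := fun h => by
    rcases (hbc d).1 h.symm with h | h
    · exact hd.2.1 h
    · exact hcd h.symm
  have dc : deg H c ≤ S.card := deg_le_card_star hcl T.adj₁₂ hb₂ hc hbc
  have dd : deg H d ≤ S.card := by
    have h := deg_le_card_star hcl T.adj₁₃ N.br₃ hd₃ hbd
    have : star H a₁ a₃ = S := by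
      ext w
      rw [hS, mem_star, mem_star]
      exact or_congr_right ⟨fun h => h.congr hcl T.swap, fun h => h.congr hcl T⟩
    rwa [this] at h
  have da₁ : deg H a₁ ≤ S.card + 1 := by
    have h := deg_le_card H a₁ ({a₂, a₃} ∪ S.erase a₁) (by
      intro y hy
      by_cases hy₂ : y = a₂
      · simp [hy₂]
      by_cases hy₃ : y = a₃
      · simp [hy₃]
      refine Finset.mem_union_right _ (Finset.mem_erase.2 ⟨hy.ne', mem_star.2 (Or.inr
        ⟨hy, hy₂, fun h => ?_⟩)⟩)
      rcases ha₂ y h with rfl | h | rfl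
      · exact hy.ne rfl
      · exact hy₃ h
      · exact hb₂.2.2 hy)
    have h3 := Finset.card_union_le {a₂, a₃} (S.erase a₁)
    have h4 := Finset.card_erase_add_one (mem_star.2 (Or.inl rfl) : a₁ ∈ star H a₁ a₂)
    rw [Finset.card_pair T.adj₂₃.ne] at h3
    rw [← hS] at h4
    omega
  have hSn : S.card < Fintype.card V := Finset.card_lt_univ_of_notMem hb₂S
  obtain ⟨b, hb, hbn⟩ := id h₁
  obtain ⟨v, hv, -, -, hint, dv⟩ := exists_interior_branch hcl T.adj₁₂ (mem_star.2 (Or.inl rfl))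
    (mem_star.2 (Or.inr hb)) hb.1.ne hbn
  rw [← hS] at dv
  have hv₃ := hv.congr hcl T
  have hvb₂ : ¬ H.Adj v b₂ := fun h => hb₂S (hint _ h)
  have hvb₃ : ¬ H.Adj v b₃ := fun h => hb₃S (hint _ h)
  have hvc : v ≠ c := fun h => hvb₂ (h ▸ hb₂c.symm)
  have hvd : v ≠ d := fun h => hvb₃ (h ▸ hb₃d.symm)
  -- If `2|S| ≤ n + 1`, the bounds `|S| - 1` for `v`, `|S|` for `c` and `d`, and `|S| + 1` for `a₁`
  -- make the required edges light and `a₁ c`, `a₁ d` exactly `Moderate`, giving `PatternZ` with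
  -- `a₃` used twice. Otherwise every vertex of `S` has degree at least `|S| - 1 ≥ n/2`.
  have key : Fintype.card V + 2 ≤ 2 * S.card := by
    by_contra hlt
    have m : ∀ w, Branch H a₁ a₂ w → deg H w ≤ S.card → Moderate H a₁ w := fun w hw hw' =>
      ⟨fun _ => by omega, fun h => absurd hw.1 h⟩
    exact hP.noZ v c d a₁ b₂ b₃ a₃ a₂ a₃
      { lvp := ⟨hv.adj hcl T.adj₁₂ hc hvc, by omega⟩
        lvq := ⟨hv.adj hcl T.adj₁₂ hd hvd, by omega⟩
        lpq := ⟨hc.adj hcl T.adj₁₂ hd hcd, by omega⟩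
        lva := ⟨hv.1.symm, by omega⟩
        eapq := Or.inl hc.1
        map := m c hc dc
        maq := m d hd dd
        eb₂ := hb₂c.symm
        lb₃ := ⟨hb₃d.symm, by omega⟩
        et := N.br₃.1.symm
        ee₂ := T.adj₁₂
        ee₃ := T.adj₁₃
        fvb₂ := hcl.far (fun h => hb₂.2.2 (h ▸ hv.1)) hvb₂
        fvb₃ := hcl.far (fun h => N.br₃.2.2 (h ▸ hv.1)) hvb₃
        fvt := hcl.far hv₃.2.1 fun h => hv₃.2.2 h.symm
        fve₂ := hcl.far hv.2.1 fun h => hv.2.2 h.symm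
        fve₃ := hcl.far hv₃.2.1 fun h => hv₃.2.2 h.symm
        fpb₃ := hcl.far (fun h => N.br₃.2.2 (h ▸ hc.1)) hcb₃
        fpt := hcl.far hc₃.2.1 fun h => hc₃.2.2 h.symm
        fpe₂ := hcl.far hc.2.1 fun h => hc.2.2 h.symm
        fpe₃ := hcl.far hc₃.2.1 fun h => hc₃.2.2 h.symm
        fqb₂ := hcl.far (fun h => hb₂.2.2 (h ▸ hd.1)) hdb₂
        fqt := hcl.far hd₃.2.1 fun h => hd₃.2.2 h.symm
        fqe₂ := hcl.far hd.2.1 fun h => hd.2.2 h.symm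
        fqe₃ := hcl.far hd₃.2.1 fun h => hd₃.2.2 h.symm
        fab₂ := hcl.far hb₂.2.1.symm hb₂.2.2
        fab₃ := hcl.far N.br₃.2.1.symm N.br₃.2.2
        fb₂₃ := hcl.far (fun h => N.br₂.2.2 (h ▸ N.br₃.1)) N.nadj₂₃
        fb₂t := hcl.far N.br₂.2.1 fun h => N.br₂.2.2 h.symm
        fb₂e₃ := hcl.far N.br₂.2.1 fun h => N.br₂.2.2 h.symm
        fb₃e₂ := hcl.far hb₃'.2.1 fun h => hb₃'.2.2 h.symm }
  have hheavy : ∀ w, w ∈ S → Heavy H w := fun w hw => by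
    have := card_star_le hcl T.adj₁₂ hw
    rw [← hS] at this
    unfold Heavy
    omega
  refine ⟨⟨hheavy _ (mem_star.2 (Or.inl rfl)), hheavy _ (mem_star.2 (Or.inr N.br₁))⟩,
    ⟨da₂, db₂, fun y hy hne => ?_⟩, da₃, db₃, fun y hy hne => ?_⟩
  · obtain rfl := ((hbc y).1 hy).resolve_left hne
    exact hheavy _ (mem_star.2 (Or.inr hc))
  · obtain rfl := ((hbd y).1 hy).resolve_left hne
    exact hheavy _ (mem_star.2 (Or.inr hd))

theorem net_adj {V : Type*} {H : SimpleGraph V} (φ : net ↪g H) :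
    (∀ i j, i ≠ j → H.Adj (φ (Sum.inl i)) (φ (Sum.inl j))) ∧
      (∀ i, H.Adj (φ (Sum.inl i)) (φ (Sum.inr i))) ∧
      (∀ i j, i ≠ j → ¬ H.Adj (φ (Sum.inl i)) (φ (Sum.inr j))) ∧
      (∀ i j, ¬ H.Adj (φ (Sum.inr i)) (φ (Sum.inr j))) ∧
      ∀ i j, φ (Sum.inr i) ≠ φ (Sum.inl j) :=
  ⟨fun _ _ h => φ.map_rel_iff.2 h, fun _ => φ.map_rel_iff.2 rfl,
    fun _ _ h h' => h (φ.map_rel_iff.1 h'), fun _ _ h => φ.map_rel_iff.1 h,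
    fun _ _ h => by simpa using φ.injective h⟩

theorem lightNet_of_not_pHeavyNet (φ : net ↪g H) (hφ : ¬ PHeavyNet H φ) (i j k : Fin 3)
    (hij : i ≠ j) (hik : i ≠ k) (hjk : j ≠ k) :
    LightNet H (φ (Sum.inl i)) (φ (Sum.inl j)) (φ (Sum.inl k)) (φ (Sum.inr i)) (φ (Sum.inr j))
      (φ (Sum.inr k)) := by
  obtain ⟨h₁, h₂, h₃, h₄, h₅⟩ := net_adj φ
  have hlt : ∀ i j, i ≠ j →
      deg H (φ (Sum.inl i)) + deg H (φ (Sum.inl j)) < Fintype.card V := fun i j hij =>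
    lt_of_not_ge fun h => hφ ⟨i, j, h₁ i j hij, h⟩
  exact ⟨⟨h₁ _ _ hij, h₁ _ _ hik, h₁ _ _ hjk, hlt _ _ hij, hlt _ _ hik, hlt _ _ hjk⟩,
    ⟨h₂ i, h₅ _ _, h₃ _ _ hij.symm⟩, ⟨h₂ j, h₅ _ _, h₃ _ _ hjk.symm⟩, ⟨h₂ k, h₅ _ _, h₃ _ _ hik⟩,
    h₄ _ _, h₄ _ _, h₄ _ _⟩

theorem qHeavyNet_of_heavyBranch (hcl : IsClosed H) (hP : PatternFree H) (h2 : TwoConnected H)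
    (φ : net ↪g H) (hφ : ¬ PHeavyNet H φ) (i j k : Fin 3) (hij : i ≠ j) (hik : i ≠ k)
    (hjk : j ≠ k) (h : HeavyBranch H (φ (Sum.inl i)) (φ (Sum.inl j))) : QHeavyNet H φ := by
  obtain ⟨h₁, h₂, h₃⟩ := (lightNet_of_not_pHeavyNet φ hφ i j k hij hik hjk).qHeavy hcl hP h2 h
  refine ⟨i, h₁, fun l hl => ?_⟩
  have : l = j ∨ l = k := by omega
  rcases this with rfl | rfl
  · exact h₂
  · exact h₃

theorem PatternFree.npqHeavy (hP : PatternFree H) (hcl : IsClosed H) (h2 : TwoConnected H) :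
    NPQHeavy H := by
  intro φ
  by_cases hφ : PHeavyNet H φ
  · exact Or.inl hφ
  right
  have N := lightNet_of_not_pHeavyNet φ hφ 0 1 2 (by decide) (by decide) (by decide)
  rcases N.exists_heavyBranch hcl hP h2 with h | h | h
  · exact qHeavyNet_of_heavyBranch hcl hP h2 φ hφ 0 1 2 (by decide) (by decide) (by decide) h
  · exact qHeavyNet_of_heavyBranch hcl hP h2 φ hφ 1 2 0 (by decide) (by decide) (by decide) h
  · exact qHeavyNet_of_heavyBranch hcl hP h2 φ hφ 2 0 1 (by decide) (by decide) (by decide) h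

theorem IsClosed.npqHeavy_of_noNet (hcl : IsClosed H)
    (hN : ∀ a₁ a₂ a₃ b₁ b₂ b₃, ¬ PatternNet H a₁ a₂ a₃ b₁ b₂ b₃) : NPQHeavy H := by
  intro φ
  left
  by_contra hφ
  obtain ⟨h₁, h₂, h₃, h₄, h₅⟩ := net_adj φ
  have hl : ∀ i j, i ≠ j → Light H (φ (Sum.inl i)) (φ (Sum.inl j)) := fun i j hij =>
    ⟨h₁ i j hij, lt_of_not_ge fun h => hφ ⟨i, j, h₁ i j hij, by omega⟩⟩
  have hf : ∀ i j, i ≠ j → Far H (φ (Sum.inl i)) (φ (Sum.inr j)) := fun i j hij =>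
    hcl.far (h₅ j i).symm (h₃ i j hij)
  have hf' : ∀ i j, i ≠ j → Far H (φ (Sum.inr i)) (φ (Sum.inr j)) := fun i j hij =>
    hcl.far (fun h => hij (by simpa using φ.injective h)) (h₄ i j)
  exact hN (φ (Sum.inl 0)) (φ (Sum.inl 1)) (φ (Sum.inl 2)) (φ (Sum.inr 0)) (φ (Sum.inr 1))
    (φ (Sum.inr 2)) (by
      constructor <;> first
        | exact h₂ _
        | exact hl _ _ (by decide)
        | exact hf _ _ (by decide)
        | exact hf' _ _ (by decide))

end Nets

end HeavyPairs

theorem mainTheorem2 {V : Type*} [Fintype V] (G : SimpleGraph V)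
    (hconn : HeavyPairs.TwoConnected G)
    (hclaw : HeavyPairs.OHeavyFor HeavyPairs.claw G)
    (hS : HeavyPairs.OHeavyFor (HeavyPairs.P 4) G ∨
      HeavyPairs.OHeavyFor (HeavyPairs.P 5) G ∨
      HeavyPairs.OHeavyFor HeavyPairs.C₃ G ∨
      HeavyPairs.OHeavyFor (HeavyPairs.Z 1) G ∨
      HeavyPairs.OHeavyFor (HeavyPairs.Z 2) G ∨
      HeavyPairs.OHeavyFor HeavyPairs.bull G ∨
      HeavyPairs.OHeavyFor HeavyPairs.net G ∨
      HeavyPairs.OHeavyFor HeavyPairs.wounded G)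
    (H : SimpleGraph V) (hH : HeavyPairs.IsCClosure G H) :
    HeavyPairs.ClawFree H ∧ HeavyPairs.NPQHeavy H := by
  obtain ⟨hGH, hx⟩ := hH
  rcases HeavyPairs.oHeavyFor_path_or_net_or_wounded hS with h | h
  · obtain ⟨hc, hN⟩ := HeavyPairs.noClaw_and_noNet_of_reflTransGen hclaw.noClaw
      (fun _ _ _ _ _ _ => h.false_of_net) hGH
    have hcl := hc.isClosed hx
    exact ⟨hcl.clawFree, hcl.npqHeavy_of_noNet hN⟩
  · have hP := (HeavyPairs.patternFree_of_oHeavyFor hclaw h).of_reflTransGen hGH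
    have hcl := hP.noClaw.isClosed hx
    exact ⟨hcl.clawFree, hP.npqHeavy hcl (hconn.mono (HeavyPairs.le_of_reflTransGen hGH))⟩
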